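/- Let $\mathbb{S}^2\subset\mathbb{R}^3$ be the round unit sphere, oriented by its outward normal, let $N=(0,0,1)$ and $S=(0,0,-1)$, and let $M=\mathbb{S}^2\setminus\{N,S\}$. Let $\vec v$ be a unit tangent vector field of class $C^1$ on $M$, and let $\vec v^{\perp}$ be the unit field for which $(\vec v^{\perp},\vec v)$ is a positively oriented orthonormal frame. With $\nabla$ the Levi-Civita connection of the round metric $g$ and $\nu$ its area element, put $\kappa=g(\nabla_{\vec v}\vec v,\vec v^{\perp})$, $\tau=g(\nabla_{\vec v^{\perp}}\vec v,\vec v^{\perp})$ and $$\mathrm{vol}(\vec v)=\int_{M}\sqrt{1+\kappa^2+\tau^2}\,\nu\in[0,\infty].$$ Let $I_{\vec v}(N),I_{\vec v}(S)\in\mathbb{Z}$ be the Poincaré indices of $\vec v$ around $N$ and $S$; these exist. Call $\vec v$ loxodromic if it crosses all parallels at the same angle, that is, if there is one $\alpha\in\mathbb{R}$ such that $\vec v=\cos\alpha\,\vec u+\sin\alpha\,\vec n$ on all of $M$, where $\vec u$ is the unit field tangent to the parallels (pointing east) and $\vec n$ is the unit field tangent to the meridians (pointing north). Then $\vec v$ attains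 the Brito–Chacón–Johnson lower bound, i.e. $$\mathrm{vol}(\vec v)=\tfrac12\bigl(\pi+|I_{\vec v}(N)|+|I_{\vec v}(S)|-2\bigr)\,\mathrm{vol}(\mathbb{S}^2),$$ if and only if $\vec v$ is loxodromic. Moreover, every loxodromic $\vec v$ satisfies $\mathrm{vol}(\vec v)=\tfrac{\pi}{2}\,\mathrm{vol}(\mathbb{S}^2)$. -/

import Mathlib

open Real MeasureTheory Filter Topology
open scoped ENNReal

noncomputable section

/-- Euclidean space `ℝ³`. -/
abbrev E3 : Type := EuclideanSpace ℝ (Fin 3)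

/-- The north pole. -/
def northPole : E3 := !₂[0, 0, 1]

/-- The south pole. -/
def southPole : E3 := !₂[0, 0, -1]

/-- The round unit sphere of `ℝ³` without the two poles. -/
def puncturedSphere : Set E3 := Metric.sphere (0 : E3) 1 \ {northPole, southPole}

/-- The cross product of `ℝ³`. For `p` on the sphere, oriented by the outward normal, and `w`
tangent at `p`, the vector `cross p w` is `w` rotated by `+π/2` in the tangent plane. -/
def cross (a b : E3) : E3 := WithLp.toLp 2 (crossProduct a.ofLp b.ofLp)

/-- The extension of a map on the sphere that is constant along rays from the origin. -/
def radialExtension (v : E3 → E3) (x : E3) : E3 := v (‖x‖⁻¹ • x)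

/-- `v` restricts to a (`C¹`) unit tangent vector field on the punctured sphere; its values
elsewhere are irrelevant. A map on the sphere is `C¹` near `p` exactly when its radial extension
to a neighbourhood of `p` in `ℝ³` is. -/
structure IsUnitVectorField (v : E3 → E3) : Prop where
  norm_eq_one : ∀ p ∈ puncturedSphere, ‖v p‖ = 1
  tangent : ∀ p ∈ puncturedSphere, inner ℝ p (v p) = 0
  contDiffAt : ∀ p ∈ puncturedSphere, ContDiffAt ℝ 1 (radialExtension v) p

/-- The Levi-Civita connection of the round sphere, `∇_X v` at `p` for `X` tangent at `p`: the
orthogonal projection to the tangent plane at `p` of the derivative of `v` in direction `X`. -/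
def covDeriv (v : E3 → E3) (p X : E3) : E3 :=
  fderiv ℝ (radialExtension v) p X - inner ℝ p (fderiv ℝ (radialExtension v) p X) • p

/-- The unit field `v^⊥` for which `(v^⊥, v)` is a positively oriented orthonormal frame. -/
def perp (v : E3 → E3) (p : E3) : E3 := cross (v p) p

/-- Geodesic curvature of the integral curves of `v`: `κ = g(∇_v v, v^⊥)`. -/
def kappa (v : E3 → E3) (p : E3) : ℝ := inner ℝ (covDeriv v p (v p)) (perp v p)

/-- Geodesic curvature of the curves orthogonal to `v`: `τ = g(∇_{v^⊥} v, v^⊥)`. -/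
def tau (v : E3 → E3) (p : E3) : ℝ := inner ℝ (covDeriv v p (perp v p)) (perp v p)

/-- The area measure of the round unit sphere. -/
def areaMeasure : Measure (Metric.sphere (0 : E3) 1) := (volume : Measure E3).toSphere

/-- The volume (area) of the round unit sphere. -/
def volSphere : ℝ≥0∞ := areaMeasure Set.univ

/-- The volume of a unit vector field on the punctured sphere (possibly infinite):
the integral of `√(1 + κ² + τ²)`. -/
def vol (v : E3 → E3) : ℝ≥0∞ :=
  ∫⁻ p in {p : Metric.sphere (0 : E3) 1 | (p : E3) ∈ puncturedSphere},
    ENNReal.ofReal (√(1 + kappa v p ^ 2 + tau v p ^ 2)) ∂areaMeasure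

/-- The geodesic circle of radius `ε` around the pole `P` (one of the two poles), parametrized by
the angle `t` in the tangent plane at `P` with respect to the basis `e₁, e₂` of that plane. -/
def poleCircle (P : E3) (ε t : ℝ) : E3 := cos ε • P + sin ε • !₂[cos t, sin t, 0]

/-- `v` has Poincaré index `m` around the pole `P`: on every small circle around `P`, the
orthogonal projection of `v` to the tangent plane `⟨e₁, e₂⟩` at `P` is nowhere zero, and its
continuous polar angle `Θ` grows by `2πm` when the circle is run through once. Circle and angle
are measured with respect to the same basis, so the orientation of that basis is immaterial. -/
def HasPoincareIndex (v : E3 → E3) (P : E3) (m : ℤ) : Prop :=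
  ∀ᶠ ε in 𝓝[>] (0 : ℝ), ∃ r Θ : ℝ → ℝ, Continuous Θ ∧ ∀ t : ℝ,
    0 < r t ∧ (v (poleCircle P ε t)) 0 = r t * cos (Θ t) ∧
    (v (poleCircle P ε t)) 1 = r t * sin (Θ t) ∧ Θ (t + 2 * π) = Θ t + 2 * π * m

open Classical in
/-- The Poincaré index of `v` around the pole `P` (with value `0` if there is none). -/
def poincareIndex (v : E3 → E3) (P : E3) : ℤ :=
  if h : ∃ m : ℤ, HasPoincareIndex v P m then h.choose else 0

/-- The unit vector `u` at `p` that is tangent to the parallel through `p` (pointing east). -/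
def east (p : E3) : E3 := (√(p 0 ^ 2 + p 1 ^ 2))⁻¹ • !₂[-p 1, p 0, 0]

/-- The unit vector `n` at `p` that is tangent to the meridian through `p` (pointing north);
`(u, n)` is a positively oriented orthonormal frame of the punctured sphere. -/
def meridian (p : E3) : E3 := cross p (east p)

/-- `v` is loxodromic: it crosses all parallels at the same angle, that is, the oriented angle
from `u` to `v` has the same value `α` at all points. -/
def IsLoxodromic (v : E3 → E3) : Prop :=
  ∃ α : ℝ, ∀ p ∈ puncturedSphere, v p = cos α • east p + sin α • meridian p

end

/-! Let `θ` be the angle from east to `v`, and use latitude `s` and longitude `φ`. Since `κ` and `τ`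
are, up to sign, the connection form of `v` on an orthonormal frame, `κ² + τ²` can be computed in
the frame (east, north). Times `cos s`, the volume density becomes `√(cos² s + (θ_φ + sin s)² + (cos
s · θ_s)²)` (`density_eq`, `vol_eq`). Only the derivatives of `θ` occur, and these are globally
defined.

The number `k` of turns of `θ` along a parallel does not depend on the parallel (`exists_winding`),
and the indices at the poles are `1 + k` and `1 - k`. So the bound is `2π(π + |1 + k| + |1 - k| -
2)`.

If `k ≠ 0`, the density strictly exceeds `± (θ_φ + sin s)`. With the sign of `k` this integrates to
`2π²|k|`, which is at least the bound, so equality never occurs (`lt_vol_of_winding_ne_zero`). If `k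
= 0`, the bound is `2π²`. By Cauchy–Schwarz the density is at least `1 + sin s · θ_φ`, whose
integral is `2π²`, and equality forces `θ_φ = θ_s = 0`, a constant angle (`angleDeriv_eq_zero`).
Conversely, a constant angle gives `k = 0` and density `1`. -/

/-! ### Integration over the sphere in geographical coordinates. -/

/-- The point of the unit sphere of latitude `s` and longitude `φ`. -/
noncomputable def spherePt (s φ : ℝ) : E3 := !₂[cos s * cos φ, cos s * sin φ, sin s]

theorem continuous_spherePt : Continuous fun x : ℝ × ℝ => spherePt x.1 x.2 := by
  unfold spherePt
  refine (PiLp.continuous_toLp 2 _).comp (continuous_pi fun i => ?_)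
  fin_cases i <;> simp <;> fun_prop

theorem norm_spherePt (s φ : ℝ) : ‖spherePt s φ‖ = 1 := by
  rw [EuclideanSpace.norm_eq, Real.sqrt_eq_one]
  simp [spherePt, Fin.sum_univ_three]
  linear_combination (cos s)^2 * sin_sq_add_cos_sq φ + sin_sq_add_cos_sq s

/-- Integration over `ℝ³` by iterated integrals. -/
theorem lintegral_E3_eq (g : E3 → ℝ≥0∞) (hg : Measurable g) :
    ∫⁻ x, g x = ∫⁻ z : ℝ, ∫⁻ w : ℝ × ℝ, g !₂[w.1, w.2, z] := by
  have e1 := (PiLp.volume_preserving_toLp (Fin 3)).lintegral_comp hg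
  rw [← e1]
  have e2 := (volume_preserving_piFinSuccAbove (fun _ : Fin 3 => ℝ) 2).symm
  have hm : Measurable fun x : Fin 3 → ℝ => g (WithLp.toLp 2 x) :=
    hg.comp (PiLp.continuous_toLp 2 _).measurable
  rw [← e2.lintegral_comp hm, Measure.volume_eq_prod, lintegral_prod]
  · refine lintegral_congr fun z => ?_
    have e3 := (volume_preserving_finTwoArrow ℝ).symm
    rw [← e3.lintegral_comp_emb (MeasurableEquiv.measurableEmbedding _)]
    refine lintegral_congr fun w => ?_
    congr 2
    ext i
    fin_cases i <;> rfl
  · exact (hm.comp (MeasurableEquiv.measurable _)).aemeasurable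

/-- Polar coordinates in the horizontal plane. The outer integral stays over all pairs `(ρ, z)`, cut
off by an indicator, so that a second polar change can be applied to `(ρ, z)`. -/
theorem lintegral_E3_polar (g : E3 → ℝ≥0∞) (hg : Measurable g) :
    ∫⁻ x, g x = ∫⁻ q : ℝ × ℝ, (Set.Ioi (0 : ℝ)).indicator (fun ρ => ∫⁻ φ in Set.Ioo (-π) π,
      ENNReal.ofReal ρ * g !₂[ρ * cos φ, ρ * sin φ, q.2]) q.1 := by
  have key : Measurable fun p : (ℝ × ℝ) × ℝ =>
      ENNReal.ofReal p.1.1 * g !₂[p.1.1 * cos p.2, p.1.1 * sin p.2, p.1.2] := by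
    refine (by fun_prop : Measurable fun p : (ℝ × ℝ) × ℝ => ENNReal.ofReal p.1.1).mul
      (hg.comp (Continuous.measurable ?_))
    refine (PiLp.continuous_toLp 2 _).comp (continuous_pi fun i => ?_)
    fin_cases i <;> simp <;> fun_prop
  have key2 : Measurable fun q : ℝ × ℝ => ∫⁻ φ in Set.Ioo (-π) π,
      ENNReal.ofReal q.1 * g !₂[q.1 * cos φ, q.1 * sin φ, q.2] := key.lintegral_prod_right'
  have key3 : Measurable fun q : ℝ × ℝ =>
      (Set.Ioi (0 : ℝ)).indicator (fun ρ => ∫⁻ φ in Set.Ioo (-π) π,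
      ENNReal.ofReal ρ * g !₂[ρ * cos φ, ρ * sin φ, q.2]) q.1 := by
    have := key2.indicator (measurable_fst measurableSet_Ioi : MeasurableSet
      (Prod.fst ⁻¹' (Set.Ioi (0 : ℝ)) : Set (ℝ × ℝ)))
    convert this using 2 with q
    by_cases h : 0 < q.1
    · rw [Set.indicator_of_mem (Set.mem_Ioi.2 h), Set.indicator_of_mem (by simpa using h)]
    · rw [Set.indicator_of_notMem (by simpa using h), Set.indicator_of_notMem (by simpa using h)]
  have e := lintegral_prod_symm _ (key3.aemeasurable (μ := (volume : Measure ℝ).prod volume))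
  rw [← Measure.volume_eq_prod] at e
  rw [lintegral_E3_eq g hg, e]
  refine lintegral_congr fun z => ?_
  dsimp only
  rw [← lintegral_comp_polarCoord_symm (fun w => g !₂[w.1, w.2, z]), lintegral_indicator
    measurableSet_Ioi, polarCoord_target, Measure.volume_eq_prod, ← Measure.prod_restrict,
    lintegral_prod]
  · simp [polarCoord]
  · simp only [polarCoord_symm_apply, smul_eq_mul]
    exact (key.comp (by fun_prop : Measurable fun x : ℝ × ℝ => ((x.1, z), x.2))).aemeasurable

theorem measurable_unit_cone (f : E3 → ℝ≥0∞) (hf : Measurable f) :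
    Measurable fun x : E3 => (Set.Iio (1 : ℝ)).indicator (fun _ => f (‖x‖⁻¹ • x)) ‖x‖ := by
  have h1 : Measurable fun x : E3 => f (‖x‖⁻¹ • x) :=
    hf.comp (measurable_norm.inv.smul measurable_id)
  have := h1.indicator (measurable_norm measurableSet_Iio : MeasurableSet
      ((fun x : E3 => ‖x‖) ⁻¹' (Set.Iio (1 : ℝ))))
  convert this using 2 with x
  by_cases h : ‖x‖ < 1
  · rw [Set.indicator_of_mem (Set.mem_Iio.2 h), Set.indicator_of_mem (by simpa using h)]
  · rw [Set.indicator_of_notMem (by simpa using h), Set.indicator_of_notMem (by simpa using h)]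

/-- Away from the origin, volume is the product of the sphere measure and `r² dr`. The integrand is
constant along rays and cut off at radius `1`, which leaves the factor `∫₀¹ r² dr = 1/3`. -/
theorem lintegral_cone_eq_toSphere (f : E3 → ℝ≥0∞) (hf : Measurable f) :
    ∫⁻ x : E3, (Set.Iio (1 : ℝ)).indicator (fun _ => f (‖x‖⁻¹ • x)) ‖x‖
      = (∫⁻ p, f p ∂areaMeasure) * ENNReal.ofReal (1 / 3) := by
  have hm := measurable_unit_cone f hf
  have mp := (volume : Measure E3).measurePreserving_homeomorphUnitSphereProd
  have e1 : ∫⁻ x : E3, (Set.Iio (1 : ℝ)).indicator (fun _ => f (‖x‖⁻¹ • x)) ‖x‖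
      = ∫⁻ x : ({0}ᶜ : Set E3),
        (Set.Iio (1 : ℝ)).indicator (fun _ => f (‖(x : E3)‖⁻¹ • (x : E3))) ‖(x : E3)‖
          ∂((volume : Measure E3).comap (↑)) := by
    rw [lintegral_subtype_comap (measurableSet_singleton _).compl
      (fun x : E3 => (Set.Iio (1 : ℝ)).indicator (fun _ => f (‖x‖⁻¹ • x)) ‖x‖),
      restrict_compl_singleton]
  have e2 := mp.lintegral_comp_emb (Homeomorph.measurableEmbedding _)
    (fun y => (Set.Iio (⟨1, Set.mem_Ioi.2 one_pos⟩ : Set.Ioi (0 : ℝ))).indicator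
      (fun _ => f (y.1 : E3)) y.2)
  rw [e1]
  have e3 : ∀ x : ({0}ᶜ : Set E3),
      (Set.Iio (1 : ℝ)).indicator (fun _ => f (‖(x : E3)‖⁻¹ • (x : E3))) ‖(x : E3)‖ =
      (Set.Iio (⟨1, Set.mem_Ioi.2 one_pos⟩ : Set.Ioi (0 : ℝ))).indicator
      (fun _ => f ((homeomorphUnitSphereProd E3 x).1 : E3)) (homeomorphUnitSphereProd E3 x).2 := by
    intro x
    simp only [Set.indicator_apply, Set.mem_Iio, homeomorphUnitSphereProd_apply_fst_coe]
    have : (homeomorphUnitSphereProd E3 x).2 < ⟨1, Set.mem_Ioi.2 one_pos⟩ ↔ ‖(x : E3)‖ < 1 := by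
      rw [← Subtype.coe_lt_coe, homeomorphUnitSphereProd_apply_snd_coe]
    simp only [this]
  rw [lintegral_congr e3, e2]
  have e4 : ∀ y : Metric.sphere (0 : E3) 1 × Set.Ioi (0 : ℝ),
      (Set.Iio (⟨1, Set.mem_Ioi.2 one_pos⟩ : Set.Ioi (0 : ℝ))).indicator
      (fun _ => f (y.1 : E3)) y.2 = f y.1 *
      (Set.Iio (⟨1, Set.mem_Ioi.2 one_pos⟩ : Set.Ioi (0 : ℝ))).indicator 1 y.2 := by
    intro y
    simp only [Set.indicator_apply]
    split_ifs <;> simp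
  rw [lintegral_congr e4, lintegral_prod_mul
    (f := fun p : Metric.sphere (0 : E3) 1 => f p)
    (g := (Set.Iio (⟨1, Set.mem_Ioi.2 one_pos⟩ : Set.Ioi (0 : ℝ))).indicator 1), lintegral_indicator_one measurableSet_Iio,
    Measure.volumeIoiPow_apply_Iio]
  · norm_num [areaMeasure]
  · exact (hf.comp measurable_subtype_coe).aemeasurable
  · exact (measurable_one.indicator measurableSet_Iio).aemeasurable

theorem lintegral_Ioo_sq : ∫⁻ r in Set.Ioi (0 : ℝ),
    (Set.Iio (1 : ℝ)).indicator (fun r => ENNReal.ofReal (r ^ 2)) r = ENNReal.ofReal (1 / 3) := by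
  rw [setLIntegral_indicator measurableSet_Iio, Set.inter_comm, Set.Ioi_inter_Iio,
    Measure.restrict_congr_set Ioo_ae_eq_Ioc, ← ofReal_integral_eq_lintegral_ofReal
      (intervalIntegral.intervalIntegrable_pow (n := 2)).1, ← intervalIntegral.integral_of_le zero_le_one]
  · norm_num
  · exact Eventually.of_forall fun r => sq_nonneg r

theorem cos_pos_iff_of_mem {s : ℝ} (h1 : -π < s) (h2 : s < π) :
    0 < cos s ↔ s ∈ Set.Ioo (-(π / 2)) (π / 2) := by
  refine ⟨fun h => ?_, fun h => cos_pos_of_mem_Ioo h⟩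
  by_contra hs
  rw [Set.mem_Ioo, not_and_or, not_lt, not_lt] at hs
  rcases hs with hs | hs
  · rw [← cos_neg] at h
    have := cos_nonpos_of_pi_div_two_le_of_le (x := -s) (by linarith) (by linarith [pi_pos])
    linarith
  · have := cos_nonpos_of_pi_div_two_le_of_le hs (by linarith [pi_pos])
    linarith

/-- Integration over the unit sphere in geographical coordinates. -/
theorem lintegral_areaMeasure (f : E3 → ℝ≥0∞) (hf : Measurable f) :
    ∫⁻ p, f p ∂areaMeasure = ∫⁻ s in Set.Ioo (-(π / 2)) (π / 2), ∫⁻ φ in Set.Ioo (-π) π,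
      ENNReal.ofReal (cos s) * f (spherePt s φ) := by
  have h1 := lintegral_cone_eq_toSphere f hf
  -- The cone integral is evaluated a second time, by two successive polar changes with `ρ = r cos
  -- s` and `z = r sin s`; the common factor `1/3` cancels at the end.
  rw [lintegral_E3_polar _ (measurable_unit_cone f hf), ← lintegral_comp_polarCoord_symm] at h1
  set J : ℝ → ℝ≥0∞ := fun s => ∫⁻ φ in Set.Ioo (-π) π,
      ENNReal.ofReal (cos s) * f (spherePt s φ) with hJ
  have hJm : Measurable J := by
    refine Measurable.lintegral_prod_right' (f := fun x : ℝ × ℝ =>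
      ENNReal.ofReal (cos x.1) * f (spherePt x.1 x.2)) ?_
    exact (by fun_prop : Measurable fun x : ℝ × ℝ => ENNReal.ofReal (cos x.1)).mul
      (hf.comp continuous_spherePt.measurable)
  have h2 : ∀ q ∈ polarCoord.target, ENNReal.ofReal q.1 •
      (Set.Ioi (0 : ℝ)).indicator (fun ρ => ∫⁻ φ in Set.Ioo (-π) π,
        ENNReal.ofReal ρ * (Set.Iio (1 : ℝ)).indicator (fun _ =>
          f (‖(!₂[ρ * cos φ, ρ * sin φ, (polarCoord.symm q).2] : E3)‖⁻¹ •
            !₂[ρ * cos φ, ρ * sin φ, (polarCoord.symm q).2]))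
          ‖(!₂[ρ * cos φ, ρ * sin φ, (polarCoord.symm q).2] : E3)‖) (polarCoord.symm q).1
      = (Set.Iio (1 : ℝ)).indicator (fun r => ENNReal.ofReal (r ^ 2)) q.1 *
        (Set.Ioo (-(π / 2)) (π / 2)).indicator J q.2 := by
    rintro ⟨r, s⟩ ⟨hr, hs⟩
    simp only [Set.mem_Ioi] at hr
    -- The condition `ρ > 0` becomes `cos s > 0`, which restricts the polar angle `s` to the range
    -- of latitudes.
    simp only [polarCoord_symm_apply, Set.indicator_apply, Set.mem_Ioi, mul_pos_iff_of_pos_left hr,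
      cos_pos_iff_of_mem hs.1 hs.2, Set.mem_Iio]
    have hpt : ∀ φ, (!₂[r * cos s * cos φ, r * cos s * sin φ, r * sin s] : E3)
        = r • spherePt s φ := by
      intro φ; ext i; fin_cases i <;> simp [spherePt, mul_assoc]
    have hn : ∀ φ, ‖r • spherePt s φ‖ = r := by
      intro φ; rw [norm_smul, norm_spherePt, mul_one, Real.norm_eq_abs, abs_of_pos hr]
    simp only [hpt, hn, smul_smul, inv_mul_cancel₀ hr.ne', one_smul]
    by_cases hc : s ∈ Set.Ioo (-(π / 2)) (π / 2)
    · by_cases hr1 : r < 1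
      · simp only [hc, hr1, if_true, hJ, smul_eq_mul]
        rw [← lintegral_const_mul' _ _ ENNReal.ofReal_ne_top,
          ← lintegral_const_mul' _ _ ENNReal.ofReal_ne_top]
        refine lintegral_congr fun φ => ?_
        rw [← mul_assoc, ← mul_assoc, ← ENNReal.ofReal_mul hr.le, ← ENNReal.ofReal_mul (by positivity)]
        congr 2
        ring
      · simp [hr1]
    · simp [hc]
  rw [setLIntegral_congr_fun polarCoord.open_target.measurableSet h2, polarCoord_target,
    Measure.volume_eq_prod, ← Measure.prod_restrict, lintegral_prod_mul, lintegral_Ioo_sq,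
    mul_comm, setLIntegral_indicator measurableSet_Ioo] at h1
  · have h3 : Set.Ioo (-(π / 2)) (π / 2) ∩ Set.Ioo (-π) π = Set.Ioo (-(π / 2)) (π / 2) := by
      apply Set.inter_eq_left.2
      exact Set.Ioo_subset_Ioo (by linarith [pi_pos]) (by linarith [pi_pos])
    rw [h3] at h1
    exact ((ENNReal.mul_left_inj (by simp) ENNReal.ofReal_ne_top).1 h1).symm
  · exact ((by fun_prop : Measurable fun r : ℝ => ENNReal.ofReal (r ^ 2)).indicator
      measurableSet_Iio).aemeasurable
  · exact (hJm.indicator measurableSet_Ioo).aemeasurable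

theorem volSphere_eq : volSphere = ENNReal.ofReal (4 * π) := by
  unfold volSphere areaMeasure
  rw [Measure.toSphere_apply_univ, EuclideanSpace.volume_ball_fin_three]
  norm_num [-ENNReal.ofReal_mul, -ENNReal.ofReal_ofNat]
  rw [← ENNReal.ofReal_ofNat 3]
  rw [← ENNReal.ofReal_mul (by norm_num)]
  congr 1
  ring

/-! ### The orthonormal frame of parallels and meridians. -/

theorem inner_E3 (x y : E3) : inner ℝ x y = x 0 * y 0 + x 1 * y 1 + x 2 * y 2 := by
  rw [PiLp.inner_apply, Fin.sum_univ_three]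
  simp [mul_comm]

/-- The unit vector pointing east at the points of longitude `φ`. -/
noncomputable def eastPt (φ : ℝ) : E3 := !₂[-sin φ, cos φ, 0]

/-- The unit vector pointing north at the point of latitude `s` and longitude `φ`. -/
noncomputable def northPt (s φ : ℝ) : E3 := !₂[-sin s * cos φ, -sin s * sin φ, cos s]

theorem spherePt_mem {s : ℝ} (hs : s ∈ Set.Ioo (-(π / 2)) (π / 2)) (φ : ℝ) :
    spherePt s φ ∈ puncturedSphere := by
  have hc := cos_pos_of_mem_Ioo hs
  have hne : spherePt s φ 0 ^ 2 + spherePt s φ 1 ^ 2 ≠ 0 := by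
    have : spherePt s φ 0 ^ 2 + spherePt s φ 1 ^ 2 = cos s ^ 2 := by
      simp [spherePt]
      linear_combination cos s ^ 2 * sin_sq_add_cos_sq φ
    rw [this]; positivity
  refine ⟨by simp [norm_spherePt], ?_⟩
  rintro (h | h)
  · exact hne (by simp [h, northPole])
  · exact hne (by rw [Set.mem_singleton_iff.1 h]; simp [southPole])

theorem exists_spherePt {p : E3} (hp : p ∈ puncturedSphere) :
    ∃ s ∈ Set.Ioo (-(π / 2)) (π / 2), ∃ φ, p = spherePt s φ := by
  obtain ⟨h1, h2⟩ := hp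
  have h1 : p 0 ^ 2 + p 1 ^ 2 + p 2 ^ 2 = 1 := by
    have h3 : ‖p‖ = 1 := by simpa using h1
    rw [EuclideanSpace.norm_eq, Real.sqrt_eq_one, Fin.sum_univ_three] at h3
    simpa using h3
  have h3 : p 0 ^ 2 + p 1 ^ 2 ≠ 0 := by
    intro h0
    have h00 : p 0 = 0 := by nlinarith [sq_nonneg (p 0), sq_nonneg (p 1)]
    have h01 : p 1 = 0 := by nlinarith [sq_nonneg (p 0), sq_nonneg (p 1)]
    have : (p 2 - 1) * (p 2 + 1) = 0 := by linear_combination h1 - h0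
    apply h2
    rcases mul_eq_zero.1 this with h | h
    · left; ext i; fin_cases i <;> simp [northPole, h00, h01]; linarith
    · right; ext i; fin_cases i <;> simp [southPole, h00, h01]; linarith
  have h4 : 0 < p 0 ^ 2 + p 1 ^ 2 := lt_of_le_of_ne (by positivity) h3.symm
  have h5 : -1 < p 2 := by nlinarith
  have h6 : p 2 < 1 := by nlinarith
  refine ⟨arcsin (p 2), ⟨neg_pi_div_two_lt_arcsin.2 h5, arcsin_lt_pi_div_two.2 h6⟩,
    Complex.arg ⟨p 0, p 1⟩, ?_⟩
  have hn : ‖(⟨p 0, p 1⟩ : ℂ)‖ = cos (arcsin (p 2)) := by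
    rw [cos_arcsin, Complex.norm_def, Complex.normSq_mk]
    congr 1
    linarith
  have hx := Complex.norm_mul_cos_arg ⟨p 0, p 1⟩
  have hy := Complex.norm_mul_sin_arg ⟨p 0, p 1⟩
  rw [hn] at hx hy
  ext i
  fin_cases i
  · simpa [spherePt] using hx.symm
  · simpa [spherePt] using hy.symm
  · simp [spherePt, sin_arcsin h5.le h6.le]

theorem east_spherePt {s : ℝ} (hs : s ∈ Set.Ioo (-(π / 2)) (π / 2)) (φ : ℝ) :
    east (spherePt s φ) = eastPt φ := by
  have hc := cos_pos_of_mem_Ioo hs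
  have : (spherePt s φ 0 ^ 2 + spherePt s φ 1 ^ 2) = cos s ^ 2 := by
    simp [spherePt]
    linear_combination cos s ^ 2 * sin_sq_add_cos_sq φ
  unfold east
  rw [this, Real.sqrt_sq hc.le]
  ext i
  fin_cases i <;> simp [spherePt, eastPt] <;> field_simp

theorem meridian_spherePt {s : ℝ} (hs : s ∈ Set.Ioo (-(π / 2)) (π / 2)) (φ : ℝ) :
    meridian (spherePt s φ) = northPt s φ := by
  unfold meridian
  rw [east_spherePt hs]
  ext i
  fin_cases i <;> simp [spherePt, eastPt, northPt, cross, crossProduct]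
  linear_combination cos s * sin_sq_add_cos_sq φ

theorem inner_spherePt_eastPt (s φ : ℝ) : inner ℝ (spherePt s φ) (eastPt φ) = 0 := by
  rw [inner_E3]; simp [spherePt, eastPt]; ring

theorem inner_spherePt_northPt (s φ : ℝ) : inner ℝ (spherePt s φ) (northPt s φ) = 0 := by
  rw [inner_E3]; simp [spherePt, northPt]
  linear_combination -cos s * sin s * sin_sq_add_cos_sq φ

theorem inner_eastPt_northPt (s φ : ℝ) : inner ℝ (eastPt φ) (northPt s φ) = 0 := by
  rw [inner_E3]; simp [northPt, eastPt]; ring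

theorem inner_eastPt_self (φ : ℝ) : inner ℝ (eastPt φ) (eastPt φ) = 1 := by
  rw [inner_E3]; simp [eastPt]; linear_combination sin_sq_add_cos_sq φ

theorem inner_northPt_self (s φ : ℝ) : inner ℝ (northPt s φ) (northPt s φ) = 1 := by
  rw [inner_E3]; simp [northPt]
  linear_combination sin s ^ 2 * sin_sq_add_cos_sq φ + sin_sq_add_cos_sq s

theorem eq_of_inner_spherePt_eq_zero {s φ : ℝ} {x : E3} (hx : inner ℝ (spherePt s φ) x = 0) :
    x = inner ℝ x (eastPt φ) • eastPt φ + inner ℝ x (northPt s φ) • northPt s φ := by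
  rw [inner_E3] at hx
  rw [inner_E3, inner_E3]
  simp only [spherePt, eastPt, northPt] at hx ⊢
  simp at hx
  have h1 := sin_sq_add_cos_sq φ
  have h2 := sin_sq_add_cos_sq s
  ext i
  fin_cases i <;> simp
  · linear_combination (-x 0) * h1 - cos φ * (cos φ * x 0 + sin φ * x 1) * h2
      + cos s * cos φ * hx
  · linear_combination (-x 1) * h1 - sin φ * (cos φ * x 0 + sin φ * x 1) * h2
      + cos s * sin φ * hx
  · linear_combination (-x 2) * h2 + sin s * hx

/-! ### The angle from the parallels to the field, through its derivatives. -/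

/-- The component of `v` in direction east. -/
noncomputable def eastComp (v : E3 → E3) (s φ : ℝ) : ℝ := inner ℝ (v (spherePt s φ)) (eastPt φ)

/-- The component of `v` in direction north. -/
noncomputable def northComp (v : E3 → E3) (s φ : ℝ) : ℝ :=
  inner ℝ (v (spherePt s φ)) (northPt s φ)

/-- The derivative of the (homogeneous extension of the) field `v`. -/
noncomputable def fieldDeriv (v : E3 → E3) (s φ : ℝ) : E3 →L[ℝ] E3 :=
  fderiv ℝ (radialExtension v) (spherePt s φ)

/-- The derivative with respect to the longitude of the angle from the parallels to `v`. -/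
noncomputable def angleDerivLong (v : E3 → E3) (s φ : ℝ) : ℝ :=
  eastComp v s φ * inner ℝ (fieldDeriv v s φ (cos s • eastPt φ)) (northPt s φ)
    - northComp v s φ * inner ℝ (fieldDeriv v s φ (cos s • eastPt φ)) (eastPt φ) - sin s

/-- The derivative with respect to the latitude of the angle from the parallels to `v`. -/
noncomputable def angleDerivLat (v : E3 → E3) (s φ : ℝ) : ℝ :=
  eastComp v s φ * inner ℝ (fieldDeriv v s φ (northPt s φ)) (northPt s φ)
    - northComp v s φ * inner ℝ (fieldDeriv v s φ (northPt s φ)) (eastPt φ)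

theorem IsUnitVectorField.eq_comp {v : E3 → E3} (hv : IsUnitVectorField v) {s : ℝ}
    (hs : s ∈ Set.Ioo (-(π / 2)) (π / 2)) (φ : ℝ) : v (spherePt s φ) =
    eastComp v s φ • eastPt φ + northComp v s φ • northPt s φ :=
  eq_of_inner_spherePt_eq_zero (hv.tangent _ (spherePt_mem hs φ))

theorem IsUnitVectorField.comp_sq {v : E3 → E3} (hv : IsUnitVectorField v) {s : ℝ}
    (hs : s ∈ Set.Ioo (-(π / 2)) (π / 2)) (φ : ℝ) : eastComp v s φ ^ 2 + northComp v s φ ^ 2 = 1 := by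
  have h1 := hv.norm_eq_one _ (spherePt_mem hs φ)
  have h2 : inner ℝ (v (spherePt s φ)) (v (spherePt s φ)) = 1 := by
    rw [real_inner_self_eq_norm_sq, h1, one_pow]
  rw [hv.eq_comp hs φ] at h2
  simp only [inner_add_left, inner_add_right, inner_smul_left, inner_smul_right,
    inner_eastPt_self, inner_northPt_self, inner_eastPt_northPt,
    real_inner_comm (eastPt φ) (northPt s φ)] at h2
  simp at h2
  linear_combination h2

theorem hasDerivAt_E3 {f : ℝ → E3} {f' : E3} {t : ℝ} :
    HasDerivAt f f' t ↔ ∀ i, HasDerivAt (fun t => f t i) (f' i) t := by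
  rw [hasDerivAt_iff_hasFDerivAt, ← hasFDerivWithinAt_univ, hasFDerivWithinAt_euclidean]
  refine forall_congr' fun i => ?_
  rw [hasDerivAt_iff_hasFDerivAt, hasFDerivWithinAt_univ]
  congr!

theorem hasDerivAt_spherePt_long (s φ : ℝ) :
    HasDerivAt (fun φ => spherePt s φ) (cos s • eastPt φ) φ := by
  rw [hasDerivAt_E3]
  intro i
  fin_cases i <;> simp [spherePt, eastPt]
  · exact ((hasDerivAt_cos φ).const_mul (cos s)).congr_deriv (by ring)
  · exact (hasDerivAt_sin φ).const_mul (cos s)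
  · exact hasDerivAt_const _ _

theorem hasDerivAt_spherePt_lat (s φ : ℝ) :
    HasDerivAt (fun s => spherePt s φ) (northPt s φ) s := by
  rw [hasDerivAt_E3]
  intro i
  fin_cases i <;> simp [spherePt, northPt]
  · exact ((hasDerivAt_cos s).mul_const (cos φ)).congr_deriv (by ring)
  · exact ((hasDerivAt_cos s).mul_const (sin φ)).congr_deriv (by ring)
  · exact hasDerivAt_sin s

theorem radialExtension_spherePt (v : E3 → E3) (s φ : ℝ) :
    radialExtension v (spherePt s φ) = v (spherePt s φ) := by
  simp [radialExtension, norm_spherePt]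

section
variable {v : E3 → E3}

theorem IsUnitVectorField.hasDerivAt_comp_spherePt (hv : IsUnitVectorField v) {γ : ℝ → ℝ × ℝ}
    {X : E3} {t : ℝ} (hs : (γ t).1 ∈ Set.Ioo (-(π / 2)) (π / 2))
    (hγ : HasDerivAt (fun t => spherePt (γ t).1 (γ t).2) X t) :
    HasDerivAt (fun t => v (spherePt (γ t).1 (γ t).2)) (fieldDeriv v (γ t).1 (γ t).2 X) t := by
  have h := ((hv.contDiffAt _ (spherePt_mem hs (γ t).2)).differentiableAt one_ne_zero).hasFDerivAt
  have h2 := h.comp_hasDerivAt t hγ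
  exact h2.congr_of_eventuallyEq
    (Eventually.of_forall fun t => (radialExtension_spherePt v _ _).symm)

/-- Differentiating `a² + b² = 1` gives `a a' + b b' = 0`, so the velocity is a multiple of `(-b,
a)`; the multiple is the angular speed `θ`. -/
theorem hasDerivAt_of_sq_add_sq {a b : ℝ → ℝ} {a' b' t θ : ℝ} (ha : HasDerivAt a a' t)
    (hb : HasDerivAt b b' t) (h : ∀ᶠ t in 𝓝 t, a t ^ 2 + b t ^ 2 = 1)
    (hθ : θ = a t * b' - b t * a') :
    HasDerivAt a (-(b t * θ)) t ∧ HasDerivAt b (a t * θ) t := by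
  have h1 := (ha.pow 2).add (hb.pow 2)
  have h2 : HasDerivAt (a ^ 2 + b ^ 2) 0 t :=
    (hasDerivAt_const t (1 : ℝ)).congr_of_eventuallyEq (by filter_upwards [h] with t ht using ht)
  have h3 := h1.unique h2
  have h4 := h.self_of_nhds
  simp at h3
  constructor
  · exact ha.congr_deriv (by rw [hθ]; linear_combination (-a') * h4 + a t / 2 * h3)
  · exact hb.congr_deriv (by rw [hθ]; linear_combination (-b') * h4 + b t / 2 * h3)

theorem hasDerivAt_eastPt (s φ : ℝ) :
    HasDerivAt eastPt (sin s • northPt s φ - cos s • spherePt s φ) φ := by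
  have h := sin_sq_add_cos_sq s
  rw [hasDerivAt_E3]
  intro i
  fin_cases i <;> simp [spherePt, eastPt, northPt]
  · exact (hasDerivAt_sin φ).neg.congr_deriv (by linear_combination cos φ * h)
  · exact (hasDerivAt_cos φ).congr_deriv (by linear_combination sin φ * h)
  · exact (hasDerivAt_const _ _).congr_deriv (by ring)

theorem hasDerivAt_northPt_long (s φ : ℝ) :
    HasDerivAt (northPt s) (-(sin s • eastPt φ)) φ := by
  rw [hasDerivAt_E3]
  intro i
  fin_cases i <;> simp [eastPt, northPt]
  · exact ((hasDerivAt_cos φ).const_mul (sin s)).neg.congr_deriv (by ring)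
  · exact ((hasDerivAt_sin φ).const_mul (sin s)).neg
  · exact hasDerivAt_const _ _

theorem hasDerivAt_northPt_lat (s φ : ℝ) :
    HasDerivAt (fun s => northPt s φ) (-spherePt s φ) s := by
  rw [hasDerivAt_E3]
  intro i
  fin_cases i <;> simp [spherePt, northPt]
  · exact ((hasDerivAt_sin s).mul_const _).neg
  · exact ((hasDerivAt_sin s).mul_const _).neg
  · exact hasDerivAt_cos s

/-- Along a parallel the frame itself rotates, which produces the term `- sin s` in
`angleDerivLong`; the radial part of the frame's derivative is invisible to the tangent field. Along
a meridian the frame is parallel and no such term arises. -/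
theorem IsUnitVectorField.hasDerivAt_long (hv : IsUnitVectorField v) {s : ℝ}
    (hs : s ∈ Set.Ioo (-(π / 2)) (π / 2)) (φ : ℝ) :
    HasDerivAt (eastComp v s) (-(northComp v s φ * angleDerivLong v s φ)) φ ∧
    HasDerivAt (northComp v s) (eastComp v s φ * angleDerivLong v s φ) φ := by
  have hV := hv.hasDerivAt_comp_spherePt (γ := fun φ => (s, φ)) hs (hasDerivAt_spherePt_long s φ)
  have ha := hV.inner ℝ (hasDerivAt_eastPt s φ)
  have hb := hV.inner ℝ (hasDerivAt_northPt_long s φ)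
  have ht := hv.tangent _ (spherePt_mem hs φ)
  refine hasDerivAt_of_sq_add_sq (a := eastComp v s) (b := northComp v s) ha hb
    (Eventually.of_forall (hv.comp_sq hs)) ?_
  have hq := hv.comp_sq hs φ
  rw [real_inner_comm] at ht
  simp only [inner_sub_right, inner_neg_right, inner_smul_right, ht]
  unfold angleDerivLong
  unfold eastComp northComp at hq ⊢
  linear_combination sin s * hq

theorem IsUnitVectorField.hasDerivAt_lat (hv : IsUnitVectorField v) {s : ℝ}
    (hs : s ∈ Set.Ioo (-(π / 2)) (π / 2)) (φ : ℝ) :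
    HasDerivAt (fun s => eastComp v s φ) (-(northComp v s φ * angleDerivLat v s φ)) s ∧
    HasDerivAt (fun s => northComp v s φ) (eastComp v s φ * angleDerivLat v s φ) s := by
  have hV := hv.hasDerivAt_comp_spherePt (γ := fun s => (s, φ)) hs (hasDerivAt_spherePt_lat s φ)
  have ha := hV.inner ℝ (hasDerivAt_const s (eastPt φ))
  have hb := hV.inner ℝ (hasDerivAt_northPt_lat s φ)
  have ht := hv.tangent _ (spherePt_mem hs φ)
  refine hasDerivAt_of_sq_add_sq (a := fun s => eastComp v s φ) (b := fun s => northComp v s φ)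
    ha hb (by filter_upwards [isOpen_Ioo.mem_nhds hs] with s hs using hv.comp_sq hs φ) ?_
  rw [real_inner_comm] at ht
  simp only [inner_neg_right, inner_zero_right, ht]
  unfold angleDerivLat eastComp northComp
  ring

/-! ### The volume density in terms of the angle. -/

theorem IsUnitVectorField.perp_spherePt (hv : IsUnitVectorField v) {s : ℝ}
    (hs : s ∈ Set.Ioo (-(π / 2)) (π / 2)) (φ : ℝ) :
    perp v (spherePt s φ) = northComp v s φ • eastPt φ - eastComp v s φ • northPt s φ := by
  unfold perp
  rw [hv.eq_comp hs φ]
  have h1 := sin_sq_add_cos_sq φ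
  have h2 := sin_sq_add_cos_sq s
  ext i
  fin_cases i <;> simp [spherePt, eastPt, northPt, cross, crossProduct]
  · linear_combination -northComp v s φ * sin φ * h2
  · linear_combination northComp v s φ * cos φ * h2
  · linear_combination -eastComp v s φ * cos s * h1

/-- The covariant derivative of `v` paired with `v^⊥` is a one-form. The sum of the squares of its
values is the same on `(v, v^⊥)` as on (east, north), where the values are, up to sign, `(θ_φ + sin
s) / cos s` and `θ_s`. -/
theorem IsUnitVectorField.density_eq (hv : IsUnitVectorField v) {s : ℝ}
    (hs : s ∈ Set.Ioo (-(π / 2)) (π / 2)) (φ : ℝ) :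
    cos s * √(1 + kappa v (spherePt s φ) ^ 2 + tau v (spherePt s φ) ^ 2) =
      √(cos s ^ 2 + (angleDerivLong v s φ + sin s) ^ 2 + (cos s * angleDerivLat v s φ) ^ 2) := by
  have hc := cos_pos_of_mem_Ioo hs
  have hq := hv.comp_sq hs φ
  have hk : kappa v (spherePt s φ) ^ 2 * cos s ^ 2 + tau v (spherePt s φ) ^ 2 * cos s ^ 2 =
      (angleDerivLong v s φ + sin s) ^ 2 + (cos s * angleDerivLat v s φ) ^ 2 := by
    unfold kappa tau covDeriv
    rw [hv.perp_spherePt hs]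
    nth_rw 1 2 [hv.eq_comp hs]
    have hD : fderiv ℝ (radialExtension v) (spherePt s φ) = fieldDeriv v s φ := rfl
    rw [hD]
    simp only [map_add, map_sub, map_smul, inner_add_left, inner_sub_left, inner_sub_right,
      inner_smul_left, inner_smul_right, inner_spherePt_eastPt, inner_spherePt_northPt,
      angleDerivLong, angleDerivLat, conj_trivial]
    set a := eastComp v s φ
    set b := northComp v s φ
    generalize inner ℝ (fieldDeriv v s φ (eastPt φ)) (eastPt φ) = x1
    generalize inner ℝ (fieldDeriv v s φ (eastPt φ)) (northPt s φ) = x2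
    generalize inner ℝ (fieldDeriv v s φ (northPt s φ)) (eastPt φ) = x3
    generalize inner ℝ (fieldDeriv v s φ (northPt s φ)) (northPt s φ) = x4
    linear_combination (cos s ^ 2 * ((a * x2 - b * x1) ^ 2 + (a * x4 - b * x3) ^ 2)) * hq
  nth_rw 1 [← Real.sqrt_sq hc.le]
  rw [← Real.sqrt_mul (by positivity)]
  congr 1
  linear_combination hk

theorem IsUnitVectorField.continuousAt_field (hv : IsUnitVectorField v) {x : ℝ × ℝ}
    (hs : x.1 ∈ Set.Ioo (-(π / 2)) (π / 2)) :
    ContinuousAt (fun x : ℝ × ℝ => v (spherePt x.1 x.2)) x := by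
  have h := (hv.contDiffAt _ (spherePt_mem hs x.2)).continuousAt
  have h2 : ContinuousAt (fun x : ℝ × ℝ => radialExtension v (spherePt x.1 x.2)) x :=
    h.comp (f := fun x : ℝ × ℝ => spherePt x.1 x.2) continuous_spherePt.continuousAt
  simpa only [radialExtension_spherePt] using h2

theorem IsUnitVectorField.continuousAt_fieldDeriv (hv : IsUnitVectorField v) {x : ℝ × ℝ}
    (hs : x.1 ∈ Set.Ioo (-(π / 2)) (π / 2)) :
    ContinuousAt (fun x : ℝ × ℝ => fieldDeriv v x.1 x.2) x := by
  have h := (hv.contDiffAt _ (spherePt_mem hs x.2)).continuousAt_fderiv one_ne_zero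
  exact h.comp (f := fun x : ℝ × ℝ => spherePt x.1 x.2) continuous_spherePt.continuousAt

theorem continuous_eastPt : Continuous eastPt := by
  refine (PiLp.continuous_toLp 2 _).comp (continuous_pi fun i => ?_)
  fin_cases i <;> simp <;> fun_prop

theorem continuous_northPt : Continuous fun x : ℝ × ℝ => northPt x.1 x.2 := by
  refine (PiLp.continuous_toLp 2 _).comp (continuous_pi fun i => ?_)
  fin_cases i <;> simp <;> fun_prop

theorem IsUnitVectorField.continuousAt_eastComp (hv : IsUnitVectorField v) {x : ℝ × ℝ}
    (hs : x.1 ∈ Set.Ioo (-(π / 2)) (π / 2)) :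
    ContinuousAt (fun x : ℝ × ℝ => eastComp v x.1 x.2) x :=
  (hv.continuousAt_field hs).inner (continuous_eastPt.comp continuous_snd).continuousAt

theorem IsUnitVectorField.continuousAt_northComp (hv : IsUnitVectorField v) {x : ℝ × ℝ}
    (hs : x.1 ∈ Set.Ioo (-(π / 2)) (π / 2)) :
    ContinuousAt (fun x : ℝ × ℝ => northComp v x.1 x.2) x :=
  (hv.continuousAt_field hs).inner continuous_northPt.continuousAt

theorem IsUnitVectorField.continuousAt_angleDerivLong (hv : IsUnitVectorField v) {x : ℝ × ℝ}
    (hs : x.1 ∈ Set.Ioo (-(π / 2)) (π / 2)) :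
    ContinuousAt (fun x : ℝ × ℝ => angleDerivLong v x.1 x.2) x := by
  have hE : ContinuousAt (fun x : ℝ × ℝ => eastPt x.2) x :=
    (continuous_eastPt.comp continuous_snd).continuousAt
  have hc : ContinuousAt (fun x : ℝ × ℝ => cos x.1) x := by fun_prop
  have hs' : ContinuousAt (fun x : ℝ × ℝ => sin x.1) x := by fun_prop
  have hD := (hv.continuousAt_fieldDeriv hs).clm_apply (hc.smul hE)
  exact (((hv.continuousAt_eastComp hs).mul (hD.inner continuous_northPt.continuousAt)).sub
    ((hv.continuousAt_northComp hs).mul (hD.inner hE))).sub hs'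

theorem IsUnitVectorField.continuousAt_angleDerivLat (hv : IsUnitVectorField v) {x : ℝ × ℝ}
    (hs : x.1 ∈ Set.Ioo (-(π / 2)) (π / 2)) :
    ContinuousAt (fun x : ℝ × ℝ => angleDerivLat v x.1 x.2) x := by
  have hE : ContinuousAt (fun x : ℝ × ℝ => eastPt x.2) x :=
    (continuous_eastPt.comp continuous_snd).continuousAt
  have hN := continuous_northPt.continuousAt (x := x)
  have hD := (hv.continuousAt_fieldDeriv hs).clm_apply hN
  exact ((hv.continuousAt_eastComp hs).mul (hD.inner hN)).sub
    ((hv.continuousAt_northComp hs).mul (hD.inner hE))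

theorem measurableSet_puncturedSphere : MeasurableSet puncturedSphere :=
  Metric.isClosed_sphere.measurableSet.diff (Set.toFinite _).measurableSet

theorem continuous_cross : Continuous fun x : E3 × E3 => cross x.1 x.2 := by
  refine (PiLp.continuous_toLp 2 _).comp (continuous_pi fun i => ?_)
  fin_cases i <;> simp [crossProduct] <;> fun_prop

theorem IsUnitVectorField.continuousOn_density (hv : IsUnitVectorField v) :
    ContinuousOn (fun p => √(1 + kappa v p ^ 2 + tau v p ^ 2)) puncturedSphere := by
  have h1 : ContinuousOn v puncturedSphere := by
    have : ContinuousOn (radialExtension v) puncturedSphere := fun p hp =>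
      (hv.contDiffAt p hp).continuousAt.continuousWithinAt
    refine this.congr fun p hp => ?_
    have : ‖p‖ = 1 := by simpa using hp.1
    simp [radialExtension, this]
  have h2 : ContinuousOn (fderiv ℝ (radialExtension v)) puncturedSphere := fun p hp =>
    ((hv.contDiffAt p hp).continuousAt_fderiv one_ne_zero).continuousWithinAt
  have h3 : ContinuousOn (perp v) puncturedSphere :=
    continuous_cross.comp_continuousOn (h1.prodMk continuousOn_id)
  have h4 : ∀ X : E3 → E3, ContinuousOn X puncturedSphere →
      ContinuousOn (fun p => covDeriv v p (X p)) puncturedSphere := fun X hX =>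
    (h2.clm_apply hX).sub ((continuousOn_id.inner (h2.clm_apply hX)).fun_smul continuousOn_id)
  have h5 : ContinuousOn (kappa v) puncturedSphere := (h4 _ h1).inner h3
  have h6 : ContinuousOn (tau v) puncturedSphere := (h4 _ h3).inner h3
  exact ((continuousOn_const.add (h5.pow 2)).add (h6.pow 2)).sqrt

/-- The volume of a unit vector field in terms of the angle it makes with the parallels. -/
theorem IsUnitVectorField.vol_eq (hv : IsUnitVectorField v) :
    vol v = ∫⁻ s in Set.Ioo (-(π / 2)) (π / 2), ∫⁻ φ in Set.Ioo (-π) π,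
      ENNReal.ofReal √(cos s ^ 2 + (angleDerivLong v s φ + sin s) ^ 2 +
        (cos s * angleDerivLat v s φ) ^ 2) := by
  classical
  -- Nothing is known about `v` off the punctured sphere, so the density is extended by zero to be
  -- measurable on all of space.
  set f : E3 → ℝ≥0∞ := puncturedSphere.indicator fun p =>
    ENNReal.ofReal √(1 + kappa v p ^ 2 + tau v p ^ 2) with hf
  have hm : Measurable f := by
    have := (ENNReal.continuous_ofReal.comp_continuousOn hv.continuousOn_density).measurable_piecewise
      (continuousOn_const (c := (0 : ℝ≥0∞))) measurableSet_puncturedSphere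
    rw [hf, ← Set.piecewise_eq_indicator]
    exact this
  have h1 : vol v = ∫⁻ p, f p ∂areaMeasure := by
    exact (lintegral_indicator (measurable_subtype_coe measurableSet_puncturedSphere) _).symm
  rw [h1, lintegral_areaMeasure f hm]
  refine setLIntegral_congr_fun measurableSet_Ioo fun s hs => ?_
  refine lintegral_congr fun φ => ?_
  rw [hf, Set.indicator_of_mem (spherePt_mem hs φ),
    ← ENNReal.ofReal_mul (cos_pos_of_mem_Ioo hs).le, hv.density_eq hs]

end

/-! ### The winding number along the parallels. -/

/-- A continuous integer-valued function on the line is constant. -/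
theorem exists_int_eq_of_continuous {f : ℝ → ℝ} (hf : Continuous f) (h : ∀ x, ∃ n : ℤ, f x = n) :
    ∃ n : ℤ, ∀ x, f x = n := by
  choose g hg using h
  have hg' : Continuous g := by
    rw [Int.isClosedEmbedding_coe_real.isEmbedding.continuous_iff]
    exact hf.congr hg
  refine ⟨g 0, fun x => ?_⟩
  rw [hg, PreconnectedSpace.constant inferInstance hg' (x := x) (y := 0)]

theorem exists_int_mul_two_pi_of_cos_sin_eq {x y : ℝ} (hc : cos x = cos y) (hs : sin x = sin y) :
    ∃ n : ℤ, x - y = 2 * π * n :=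
  Real.Angle.angle_eq_iff_two_pi_dvd_sub.1 (Real.Angle.cos_sin_inj hc hs)

/-- A differentiable curve on the unit circle has a differentiable polar angle. -/
theorem exists_angle {a b θ' : ℝ → ℝ} (hθ : Continuous θ')
    (ha : ∀ t, HasDerivAt a (-(b t * θ' t)) t) (hb : ∀ t, HasDerivAt b (a t * θ' t) t)
    (hab : a 0 ^ 2 + b 0 ^ 2 = 1) :
    ∃ Θ : ℝ → ℝ, (∀ t, HasDerivAt Θ (θ' t) t) ∧ ∀ t, a t = cos (Θ t) ∧ b t = sin (Θ t) := by
  have hz : ‖(⟨a 0, b 0⟩ : ℂ)‖ = 1 := by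
    rw [Complex.norm_def, Complex.normSq_mk, Real.sqrt_eq_one]; linarith
  have h1 := Complex.norm_mul_cos_arg ⟨a 0, b 0⟩
  have h2 := Complex.norm_mul_sin_arg ⟨a 0, b 0⟩
  rw [hz, one_mul] at h1 h2
  set Θ : ℝ → ℝ := fun t => Complex.arg ⟨a 0, b 0⟩ + ∫ x in (0 : ℝ)..t, θ' x with hΘ
  have hd : ∀ t, HasDerivAt Θ (θ' t) t := fun t =>
    (hθ.integral_hasStrictDerivAt 0 t).hasDerivAt.const_add _
  have h0 : Θ 0 = Complex.arg ⟨a 0, b 0⟩ := by simp [hΘ]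
  -- Rotating `(a, b)` back by `Θ` gives a constant vector, which is `(1, 0)` by its value at `0`.
  have hf : ∀ t, HasDerivAt (fun t => a t * cos (Θ t) + b t * sin (Θ t)) 0 t := fun t =>
    (((ha t).mul (hd t).cos).add ((hb t).mul (hd t).sin)).congr_deriv (by ring)
  have hg : ∀ t, HasDerivAt (fun t => b t * cos (Θ t) - a t * sin (Θ t)) 0 t := fun t =>
    (((hb t).mul (hd t).cos).sub ((ha t).mul (hd t).sin)).congr_deriv (by ring)
  have hf' := is_const_of_deriv_eq_zero (fun t => (hf t).differentiableAt) fun t => (hf t).deriv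
  have hg' := is_const_of_deriv_eq_zero (fun t => (hg t).differentiableAt) fun t => (hg t).deriv
  refine ⟨Θ, hd, fun t => ?_⟩
  have e1 := hf' t 0
  have e2 := hg' t 0
  simp only [h0, h1, h2] at e1 e2
  have e3 := sin_sq_add_cos_sq (Θ t)
  constructor
  · linear_combination (-a t) * e3 + cos (Θ t) * (e1 + hab) - sin (Θ t) * e2
  · linear_combination (-b t) * e3 + sin (Θ t) * (e1 + hab) + cos (Θ t) * e2

theorem spherePt_add_two_pi (s φ : ℝ) : spherePt s (φ + 2 * π) = spherePt s φ := by
  simp [spherePt]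

theorem eastPt_add_two_pi (φ : ℝ) : eastPt (φ + 2 * π) = eastPt φ := by simp [eastPt]

theorem northPt_add_two_pi (s φ : ℝ) : northPt s (φ + 2 * π) = northPt s φ := by simp [northPt]

theorem eastComp_add_two_pi (v : E3 → E3) (s φ : ℝ) :
    eastComp v s (φ + 2 * π) = eastComp v s φ := by
  simp only [eastComp, spherePt_add_two_pi, eastPt_add_two_pi]

theorem northComp_add_two_pi (v : E3 → E3) (s φ : ℝ) :
    northComp v s (φ + 2 * π) = northComp v s φ := by
  simp only [northComp, spherePt_add_two_pi, northPt_add_two_pi]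

theorem angleDerivLong_add_two_pi (v : E3 → E3) (s φ : ℝ) :
    angleDerivLong v s (φ + 2 * π) = angleDerivLong v s φ := by
  simp only [angleDerivLong, fieldDeriv, eastComp_add_two_pi, northComp_add_two_pi,
    spherePt_add_two_pi, northPt_add_two_pi, eastPt_add_two_pi]

theorem IsUnitVectorField.continuous_angleDerivLong {v : E3 → E3} (hv : IsUnitVectorField v)
    {s : ℝ} (hs : s ∈ Set.Ioo (-(π / 2)) (π / 2)) : Continuous (angleDerivLong v s) :=
  continuous_iff_continuousAt.2 fun φ =>
    (hv.continuousAt_angleDerivLong (x := (s, φ)) hs).comp (f := fun φ => (s, φ)) (by fun_prop)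

/-- `Θ` is an angle from the parallel of latitude `s` to `v`, and it makes `k` turns. -/
structure IsAngleAlong (v : E3 → E3) (s : ℝ) (k : ℤ) (Θ : ℝ → ℝ) : Prop where
  hasDerivAt : ∀ φ, HasDerivAt Θ (angleDerivLong v s φ) φ
  eastComp_eq : ∀ φ, eastComp v s φ = cos (Θ φ)
  northComp_eq : ∀ φ, northComp v s φ = sin (Θ φ)
  add_two_pi : ∀ φ, Θ (φ + 2 * π) = Θ φ + 2 * π * k

theorem IsAngleAlong.continuous {v : E3 → E3} {s : ℝ} {k : ℤ} {Θ : ℝ → ℝ}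
    (h : IsAngleAlong v s k Θ) : Continuous Θ :=
  continuous_iff_continuousAt.2 fun φ => (h.hasDerivAt φ).continuousAt

theorem IsAngleAlong.integral_eq {v : E3 → E3} (hv : IsUnitVectorField v) {s : ℝ}
    (hs : s ∈ Set.Ioo (-(π / 2)) (π / 2)) {k : ℤ} {Θ : ℝ → ℝ} (h : IsAngleAlong v s k Θ) :
    ∫ φ in (-π)..π, angleDerivLong v s φ = 2 * π * k := by
  rw [intervalIntegral.integral_eq_sub_of_hasDerivAt (fun φ _ => h.hasDerivAt φ)
    ((hv.continuous_angleDerivLong hs).intervalIntegrable _ _)]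
  have := h.add_two_pi (-π)
  rw [show -π + 2 * π = π by ring] at this
  linarith

/-- The increment of `Θ` over a period is constant because its derivative is periodic, and a
multiple of `2π` because the components of `v` are periodic. -/
theorem IsUnitVectorField.exists_isAngleAlong {v : E3 → E3} (hv : IsUnitVectorField v) {s : ℝ}
    (hs : s ∈ Set.Ioo (-(π / 2)) (π / 2)) : ∃ k Θ, IsAngleAlong v s k Θ := by
  obtain ⟨Θ, hd, hΘ⟩ := exists_angle (hv.continuous_angleDerivLong hs)
    (fun φ => (hv.hasDerivAt_long hs φ).1) (fun φ => (hv.hasDerivAt_long hs φ).2)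
    (hv.comp_sq hs 0)
  have hconst : ∀ t, HasDerivAt (fun t => Θ (t + 2 * π) - Θ t) 0 t := fun t =>
    (((hd (t + 2 * π)).comp_add_const t (2 * π)).sub (hd t)).congr_deriv
      (by rw [angleDerivLong_add_two_pi, sub_self])
  have hc := is_const_of_deriv_eq_zero (fun t => (hconst t).differentiableAt)
    fun t => (hconst t).deriv
  obtain ⟨k, hk⟩ := exists_int_mul_two_pi_of_cos_sin_eq
    (x := Θ (0 + 2 * π)) (y := Θ 0)
    (by rw [← (hΘ _).1, ← (hΘ _).1, eastComp_add_two_pi])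
    (by rw [← (hΘ _).2, ← (hΘ _).2, northComp_add_two_pi])
  refine ⟨k, Θ, hd, fun φ => (hΘ φ).1, fun φ => (hΘ φ).2, fun φ => ?_⟩
  have := hc φ 0
  linarith

/-- The number of turns that `v` makes against the parallels is the same on all parallels. -/
theorem IsUnitVectorField.exists_winding {v : E3 → E3} (hv : IsUnitVectorField v) :
    ∃ k : ℤ, ∀ s ∈ Set.Ioo (-(π / 2)) (π / 2), ∃ Θ, IsAngleAlong v s k Θ := by
  -- Substituting `s = arctan x` turns the open interval of latitudes into the whole line, where a
  -- continuous integer-valued function is constant.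
  have hcont : Continuous fun x : ℝ =>
      (∫ φ in (-π)..π, angleDerivLong v (arctan x) φ) / (2 * π) := by
    refine Continuous.div_const ?_ _
    refine intervalIntegral.continuous_parametric_intervalIntegral_of_continuous' ?_ _ _
    exact continuous_iff_continuousAt.2 fun p =>
      (hv.continuousAt_angleDerivLong (x := (arctan p.1, p.2)) (arctan_mem_Ioo _)).comp
        (f := fun p : ℝ × ℝ => (arctan p.1, p.2)) (by fun_prop)
  obtain ⟨n, hn⟩ := exists_int_eq_of_continuous hcont fun x => by
    obtain ⟨k, Θ, h⟩ := hv.exists_isAngleAlong (arctan_mem_Ioo x)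
    exact ⟨k, by rw [h.integral_eq hv (arctan_mem_Ioo x)]; field_simp⟩
  refine ⟨n, fun s hs => ?_⟩
  obtain ⟨k, Θ, h⟩ := hv.exists_isAngleAlong hs
  have := hn (tan s)
  rw [arctan_tan hs.1 hs.2, h.integral_eq hv hs, mul_div_cancel_left₀ _ (by positivity)] at this
  have hkn : k = n := by exact_mod_cast this
  exact ⟨Θ, hkn ▸ h⟩

/-! ### Poincaré indices at the poles. -/

/-- The polar angle of `(cos Θ, c sin Θ)`, for `c > 0`, differs from `Θ` by a function of `Θ` of
period `2π`. -/
theorem exists_angle_of_scale {c : ℝ} (hc : 0 < c) : ∃ δ r : ℝ → ℝ, Continuous δ ∧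
    Function.Periodic δ (2 * π) ∧ ∀ t, 0 < r t ∧ r t * cos (t + δ t) = cos t ∧
      r t * sin (t + δ t) = c * sin t := by
  have hx : ∀ t, 0 < cos t ^ 2 + c * sin t ^ 2 := fun t => by
    rcases eq_or_ne (cos t) 0 with h | h
    · have := sin_sq_add_cos_sq t
      rw [h] at this ⊢
      nlinarith
    · positivity
  -- This is the subtraction formula for the tangent: the new angle has tangent `c tan t`, so the
  -- difference has tangent `(c - 1) tan t / (1 + c tan² t)`, here cleared of its poles.
  refine ⟨fun t => arctan ((c - 1) * sin t * cos t / (cos t ^ 2 + c * sin t ^ 2)),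
    fun t => (cos t ^ 2 + c * sin t ^ 2) /
      cos (arctan ((c - 1) * sin t * cos t / (cos t ^ 2 + c * sin t ^ 2))), ?_, ?_, fun t => ?_⟩
  · exact continuous_arctan.comp (Continuous.div (by fun_prop) (by fun_prop) fun t => (hx t).ne')
  · intro t; simp
  · set x := cos t ^ 2 + c * sin t ^ 2 with hxd
    set δ := arctan ((c - 1) * sin t * cos t / x) with hδ
    have h1 : 0 < cos δ := cos_arctan_pos _
    have h2 : sin δ / cos δ = (c - 1) * sin t * cos t / x := by
      rw [← tan_eq_sin_div_cos, tan_arctan]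
    have h3 : x / cos δ * cos δ = x := by field_simp
    have h4 : x / cos δ * sin δ = (c - 1) * sin t * cos t := by
      rw [div_mul_eq_mul_div, mul_div_assoc, h2, mul_div_cancel₀ _ (hx t).ne']
    have h5 := sin_sq_add_cos_sq t
    refine ⟨div_pos (hx t) h1, ?_, ?_⟩
    · rw [cos_add]
      linear_combination cos t * h3 - sin t * h4 + cos t * hxd + cos t * h5
    · rw [sin_add]
      linear_combination sin t * h3 + cos t * h4 + sin t * hxd + c * sin t * h5

theorem poleCircle_northPole (ε t : ℝ) : poleCircle northPole ε t = spherePt (π / 2 - ε) t := by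
  ext i
  fin_cases i <;> simp [poleCircle, northPole, spherePt, cos_pi_div_two_sub, sin_pi_div_two_sub]

theorem poleCircle_southPole (ε t : ℝ) : poleCircle southPole ε t = spherePt (ε - π / 2) t := by
  ext i
  fin_cases i <;> simp [poleCircle, southPole, spherePt, cos_sub_pi_div_two, sin_sub_pi_div_two]

theorem IsUnitVectorField.coord_zero {v : E3 → E3} (hv : IsUnitVectorField v) {s : ℝ}
    (hs : s ∈ Set.Ioo (-(π / 2)) (π / 2)) (φ : ℝ) : v (spherePt s φ) 0 =
      -eastComp v s φ * sin φ - northComp v s φ * sin s * cos φ := by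
  rw [hv.eq_comp hs]
  simp [eastPt, northPt]
  ring

theorem IsUnitVectorField.coord_one {v : E3 → E3} (hv : IsUnitVectorField v) {s : ℝ}
    (hs : s ∈ Set.Ioo (-(π / 2)) (π / 2)) (φ : ℝ) : v (spherePt s φ) 1 =
      eastComp v s φ * cos φ - northComp v s φ * sin s * sin φ := by
  rw [hv.eq_comp hs]
  simp [eastPt, northPt]
  ring

theorem eventually_mem_Ioo_pi_div_two : ∀ᶠ ε in 𝓝[>] (0 : ℝ), ε ∈ Set.Ioo 0 (π / 2) :=
  Ioo_mem_nhdsGT (by positivity)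

/-- Projected to the plane, the field is `(cos Θ, sin s · sin Θ)` in the frame (east, inward
radial). The positive factor `sin s` does not change the number of turns, and the frame adds one
turn of its own; it starts at angle `π / 2`. -/
theorem hasPoincareIndex_northPole {v : E3 → E3} (hv : IsUnitVectorField v) {k : ℤ}
    (hk : ∀ s ∈ Set.Ioo (-(π / 2)) (π / 2), ∃ Θ, IsAngleAlong v s k Θ) :
    HasPoincareIndex v northPole (1 + k) := by
  filter_upwards [eventually_mem_Ioo_pi_div_two] with ε hε
  have hs : π / 2 - ε ∈ Set.Ioo (-(π / 2)) (π / 2) :=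
    ⟨by linarith [hε.2, pi_pos], by linarith [hε.1]⟩
  obtain ⟨Θ, h⟩ := hk _ hs
  have hc : 0 < sin (π / 2 - ε) := by
    rw [sin_pi_div_two_sub]
    exact cos_pos_of_mem_Ioo ⟨by linarith [hε.1, pi_pos], hε.2⟩
  obtain ⟨δ, r, hδ, hper, hr⟩ := exists_angle_of_scale hc
  refine ⟨fun t => r (Θ t), fun t => Θ t + δ (Θ t) + t + π / 2, ?_, fun t => ?_⟩
  · have := h.continuous
    fun_prop
  · obtain ⟨h1, h2, h3⟩ := hr (Θ t)
    refine ⟨h1, ?_, ?_, ?_⟩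
    · rw [poleCircle_northPole, hv.coord_zero hs, cos_add_pi_div_two, sin_add, h.eastComp_eq,
        h.northComp_eq]
      linear_combination sin t * h2 + cos t * h3
    · rw [poleCircle_northPole, hv.coord_one hs, sin_add_pi_div_two, cos_add, h.eastComp_eq,
        h.northComp_eq]
      linear_combination -cos t * h2 + sin t * h3
    · dsimp only
      rw [h.add_two_pi, mul_comm (2 * π) (k : ℝ), hper.int_mul k]
      push_cast
      ring

/-- Near this pole north projects to the outward radial direction, with the positive factor `-sin
s`. The projected frame is negatively oriented, so the turns of `Θ` count negatively. -/
theorem hasPoincareIndex_southPole {v : E3 → E3} (hv : IsUnitVectorField v) {k : ℤ}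
    (hk : ∀ s ∈ Set.Ioo (-(π / 2)) (π / 2), ∃ Θ, IsAngleAlong v s k Θ) :
    HasPoincareIndex v southPole (1 - k) := by
  filter_upwards [eventually_mem_Ioo_pi_div_two] with ε hε
  have hs : ε - π / 2 ∈ Set.Ioo (-(π / 2)) (π / 2) :=
    ⟨by linarith [hε.1], by linarith [hε.2, pi_pos]⟩
  obtain ⟨Θ, h⟩ := hk _ hs
  have hc : 0 < -sin (ε - π / 2) := by
    rw [sin_sub_pi_div_two, neg_neg]
    exact cos_pos_of_mem_Ioo ⟨by linarith [hε.1, pi_pos], hε.2⟩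
  obtain ⟨δ, r, hδ, hper, hr⟩ := exists_angle_of_scale hc
  refine ⟨fun t => r (Θ t), fun t => t - (Θ t + δ (Θ t)) + π / 2, ?_, fun t => ?_⟩
  · have := h.continuous
    fun_prop
  · obtain ⟨h1, h2, h3⟩ := hr (Θ t)
    refine ⟨h1, ?_, ?_, ?_⟩
    · rw [poleCircle_southPole, hv.coord_zero hs, cos_add_pi_div_two, sin_sub t, h.eastComp_eq,
        h.northComp_eq]
      linear_combination sin t * h2 - cos t * h3
    · rw [poleCircle_southPole, hv.coord_one hs, sin_add_pi_div_two, cos_sub t, h.eastComp_eq,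
        h.northComp_eq]
      linear_combination -cos t * h2 - sin t * h3
    · dsimp only
      rw [h.add_two_pi, mul_comm (2 * π) (k : ℝ), hper.int_mul k]
      push_cast
      ring

/-- On a circle that serves both indices, the two polar angles of the same nonzero vector differ by
a continuous multiple of `2π`, hence by a constant, and so grow equally. -/
theorem HasPoincareIndex.unique {v : E3 → E3} {P : E3} {m n : ℤ} (hm : HasPoincareIndex v P m)
    (hn : HasPoincareIndex v P n) : m = n := by
  obtain ⟨ε, ⟨r₁, Θ₁, hc₁, h₁⟩, r₂, Θ₂, hc₂, h₂⟩ := (hm.and hn).exists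
  have key : ∀ t, ∃ l : ℤ, (Θ₁ t - Θ₂ t) / (2 * π) = l := by
    intro t
    obtain ⟨p1, x1, y1, -⟩ := h₁ t
    obtain ⟨p2, x2, y2, -⟩ := h₂ t
    have hx := x1.symm.trans x2
    have hy := y1.symm.trans y2
    have hr : r₁ t = r₂ t := by
      refine (pow_left_inj₀ p1.le p2.le two_ne_zero).1 ?_
      have e1 := sin_sq_add_cos_sq (Θ₁ t)
      have e2 := sin_sq_add_cos_sq (Θ₂ t)
      linear_combination (r₁ t * cos (Θ₁ t) + r₂ t * cos (Θ₂ t)) * hx +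
        (r₁ t * sin (Θ₁ t) + r₂ t * sin (Θ₂ t)) * hy - r₁ t ^ 2 * e1 + r₂ t ^ 2 * e2
    rw [← hr] at hx hy
    obtain ⟨l, hl⟩ := exists_int_mul_two_pi_of_cos_sin_eq (mul_left_cancel₀ p1.ne' hx)
      (mul_left_cancel₀ p1.ne' hy)
    exact ⟨l, by rw [hl]; field_simp⟩
  obtain ⟨l, hl⟩ := exists_int_eq_of_continuous ((hc₁.sub hc₂).div_const _) key
  have e0 := hl 0
  have e1 := hl (0 + 2 * π)
  rw [Pi.sub_apply, (h₁ 0).2.2.2, (h₂ 0).2.2.2] at e1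
  rw [← e0, Pi.sub_apply] at e1
  field_simp at e1
  have : (m : ℝ) = n := by nlinarith [pi_pos]
  exact_mod_cast this

theorem HasPoincareIndex.poincareIndex_eq {v : E3 → E3} {P : E3} {m : ℤ}
    (hm : HasPoincareIndex v P m) : poincareIndex v P = m := by
  have h : ∃ m : ℤ, HasPoincareIndex v P m := ⟨m, hm⟩
  rw [poincareIndex, dif_pos h]
  exact h.choose_spec.unique hm

/-! ### Lower bounds for the volume and the case of equality. -/

/-- If `G ≤ F` are continuous in the second variable, and the double integral of `F` is at most
that of `G`, then `F = G` on almost every line. -/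
theorem ae_eq_of_lintegral_le {F G : ℝ → ℝ → ℝ} {h : ℝ → ℝ}
    (hF : ContinuousOn (fun x : ℝ × ℝ => F x.1 x.2) (Set.Ioo (-(π / 2)) (π / 2) ×ˢ Set.univ))
    (hF0 : ∀ s φ, 0 ≤ F s φ)
    (hG : ∀ s ∈ Set.Ioo (-(π / 2)) (π / 2), Continuous (G s))
    (hle : ∀ s ∈ Set.Ioo (-(π / 2)) (π / 2), ∀ φ, G s φ ≤ F s φ)
    (hh : Continuous h) (hh0 : ∀ s, 0 ≤ h s)
    (hGh : ∀ s ∈ Set.Ioo (-(π / 2)) (π / 2), ∫ φ in (-π)..π, G s φ = h s)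
    (hint : ∫⁻ s in Set.Ioo (-(π / 2)) (π / 2), ∫⁻ φ in Set.Ioo (-π) π, ENNReal.ofReal (F s φ) ≤
      ENNReal.ofReal (∫ s in (-(π / 2))..(π / 2), h s)) :
    ∀ᵐ s ∂(volume.restrict (Set.Ioo (-(π / 2)) (π / 2))), ∀ φ ∈ Set.Icc (-π) π, F s φ = G s φ := by
  have hFc : ∀ s ∈ Set.Ioo (-(π / 2)) (π / 2), Continuous (F s) := fun s hs => by
    refine continuousOn_univ.1 (hF.comp (f := fun φ => (s, φ)) (by fun_prop) fun φ _ => ?_)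
    exact ⟨hs, Set.mem_univ _⟩
  have hpi : -π ≤ π := by linarith [pi_pos]
  have hpi2 : -(π / 2) ≤ π / 2 := by linarith [pi_pos]
  have hJ : ∀ s ∈ Set.Ioo (-(π / 2)) (π / 2),
      ∫⁻ φ in Set.Ioo (-π) π, ENNReal.ofReal (F s φ) =
        ENNReal.ofReal (∫ φ in (-π)..π, F s φ) := fun s hs => by
    rw [intervalIntegral.integral_of_le hpi, Measure.restrict_congr_set Ioo_ae_eq_Ioc,
      ofReal_integral_eq_lintegral_ofReal ((hFc s hs).intervalIntegrable _ _).1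
        (Eventually.of_forall fun φ => hF0 s φ)]
  have hH : ∫⁻ s in Set.Ioo (-(π / 2)) (π / 2), ENNReal.ofReal (h s) =
      ENNReal.ofReal (∫ s in (-(π / 2))..(π / 2), h s) := by
    rw [intervalIntegral.integral_of_le hpi2, Measure.restrict_congr_set Ioo_ae_eq_Ioc,
      ofReal_integral_eq_lintegral_ofReal (hh.intervalIntegrable _ _).1
        (Eventually.of_forall fun s => hh0 s)]
  have hmono : ∀ s ∈ Set.Ioo (-(π / 2)) (π / 2), h s ≤ ∫ φ in (-π)..π, F s φ := fun s hs => by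
    rw [← hGh s hs]
    exact intervalIntegral.integral_mono_on hpi ((hG s hs).intervalIntegrable _ _)
      ((hFc s hs).intervalIntegrable _ _) fun φ _ => hle s hs φ
  have hmeas : AEMeasurable (fun s => ∫⁻ φ in Set.Ioo (-π) π, ENNReal.ofReal (F s φ))
      (volume.restrict (Set.Ioo (-(π / 2)) (π / 2))) := by
    refine AEMeasurable.lintegral_prod_right' (f := fun x : ℝ × ℝ => ENNReal.ofReal (F x.1 x.2)) ?_
    rw [Measure.prod_restrict]
    refine ContinuousOn.aemeasurable ?_ (measurableSet_Ioo.prod measurableSet_Ioo)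
    exact ENNReal.continuous_ofReal.comp_continuousOn
      (hF.mono (Set.prod_mono_right (Set.subset_univ _)))
  -- The line integrals of `F` dominate `h` but have no larger total, and this total is finite, so
  -- they agree with `h` for almost every `s`.
  have hae := ae_eq_of_ae_le_of_lintegral_le
    (f := fun s => ENNReal.ofReal (h s)) (μ := volume.restrict (Set.Ioo (-(π / 2)) (π / 2)))
    (g := fun s => ∫⁻ φ in Set.Ioo (-π) π, ENNReal.ofReal (F s φ))
    ((ae_restrict_iff' measurableSet_Ioo).2 (Eventually.of_forall fun s hs => by
      simp only [hJ s hs]; exact ENNReal.ofReal_le_ofReal (hmono s hs)))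
    (by rw [hH]; exact ENNReal.ofReal_ne_top) hmeas (by rw [hH]; exact hint)
  filter_upwards [hae, ae_restrict_mem measurableSet_Ioo] with s hs1 hs φ hφ
  rw [hJ s hs, ENNReal.ofReal_eq_ofReal_iff (hh0 s) ((hh0 s).trans (hmono s hs)),
    ← hGh s hs] at hs1
  -- A strict inequality at one point would, by continuity on this line, make the integrals differ.
  by_contra hne
  have := intervalIntegral.integral_lt_integral_of_continuousOn_of_le_of_exists_lt
    (by linarith [pi_pos]) (hG s hs).continuousOn (hFc s hs).continuousOn
    (fun φ _ => hle s hs φ) ⟨φ, hφ, lt_of_le_of_ne (hle s hs φ) (Ne.symm hne)⟩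
  exact this.ne hs1

theorem exists_mem_of_ae_Ioo {p : ℝ → Prop}
    (h : ∀ᵐ s ∂(volume.restrict (Set.Ioo (-(π / 2)) (π / 2))), p s) :
    ∃ s ∈ Set.Ioo (-(π / 2)) (π / 2), p s := by
  have : NeBot (ae (volume.restrict (Set.Ioo (-(π / 2)) (π / 2)))) := by
    rw [ae_neBot, Ne, Measure.restrict_eq_zero, Real.volume_Ioo, ENNReal.ofReal_eq_zero]
    linarith [pi_pos]
  exact ((ae_restrict_mem measurableSet_Ioo).and h).exists

section
variable {v : E3 → E3}

theorem IsUnitVectorField.continuousOn_areaDensity (hv : IsUnitVectorField v) :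
    ContinuousOn (fun x : ℝ × ℝ => √(cos x.1 ^ 2 + (angleDerivLong v x.1 x.2 + sin x.1) ^ 2 +
      (cos x.1 * angleDerivLat v x.1 x.2) ^ 2)) (Set.Ioo (-(π / 2)) (π / 2) ×ˢ Set.univ) := by
  have h1 : ContinuousOn (fun x : ℝ × ℝ => angleDerivLong v x.1 x.2)
      (Set.Ioo (-(π / 2)) (π / 2) ×ˢ Set.univ) := fun x hx =>
    (hv.continuousAt_angleDerivLong hx.1).continuousWithinAt
  have h2 : ContinuousOn (fun x : ℝ × ℝ => angleDerivLat v x.1 x.2)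
      (Set.Ioo (-(π / 2)) (π / 2) ×ˢ Set.univ) := fun x hx =>
    (hv.continuousAt_angleDerivLat hx.1).continuousWithinAt
  fun_prop

/-- If `v` turns against the parallels, its volume is greater than the bound. -/
theorem IsUnitVectorField.lt_vol_of_winding_ne_zero (hv : IsUnitVectorField v) {k : ℤ}
    (hk0 : k ≠ 0) (hk : ∀ s ∈ Set.Ioo (-(π / 2)) (π / 2), ∃ Θ, IsAngleAlong v s k Θ) :
    ENNReal.ofReal (2 * π ^ 2 * |(k : ℝ)|) < vol v := by
  by_contra! hle
  rw [hv.vol_eq] at hle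
  -- `σ` is the sign of `k`. The comparison below is strict because `cos s > 0`, and the term `σ sin
  -- s` integrates to zero over the latitudes.
  obtain ⟨σ, hσ, hσk⟩ : ∃ σ : ℝ, |σ| = 1 ∧ σ * k = |(k : ℝ)| := by
    rcases le_total 0 (k : ℝ) with h | h
    · exact ⟨1, by simp, by rw [abs_of_nonneg h, one_mul]⟩
    · exact ⟨-1, by simp, by rw [abs_of_nonpos h]; ring⟩
  have hk1 : 1 ≤ |(k : ℝ)| := by exact_mod_cast Int.one_le_abs hk0
  have hlt : ∀ s ∈ Set.Ioo (-(π / 2)) (π / 2), ∀ φ, σ * (angleDerivLong v s φ + sin s) <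
      √(cos s ^ 2 + (angleDerivLong v s φ + sin s) ^ 2 + (cos s * angleDerivLat v s φ) ^ 2) := by
    intro s hs φ
    refine Real.lt_sqrt_of_sq_lt ?_
    rw [mul_pow, ← sq_abs σ, hσ]
    have := cos_pos_of_mem_Ioo hs
    nlinarith [sq_nonneg (cos s * angleDerivLat v s φ), pow_pos this 2]
  have hae := ae_eq_of_lintegral_le (G := fun s φ => σ * (angleDerivLong v s φ + sin s))
    (h := fun s => 2 * π * (|(k : ℝ)| + σ * sin s)) hv.continuousOn_areaDensity
    (fun s φ => Real.sqrt_nonneg _)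
    (fun s hs => ((hv.continuous_angleDerivLong hs).add continuous_const).const_mul _)
    (fun s hs φ => (hlt s hs φ).le) (by fun_prop) (fun s => ?_) (fun s hs => ?_) ?_
  · obtain ⟨s, hs, h⟩ := exists_mem_of_ae_Ioo hae
    exact (hlt s hs 0).ne' (h 0 ⟨by linarith [pi_pos], pi_pos.le⟩)
  · have : |σ * sin s| ≤ 1 := by rw [abs_mul, hσ, one_mul]; exact abs_sin_le_one s
    have := (abs_le.1 this).1
    exact mul_nonneg (by positivity) (by linarith)
  · obtain ⟨Θ, h⟩ := hk s hs
    rw [intervalIntegral.integral_const_mul, intervalIntegral.integral_add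
      ((hv.continuous_angleDerivLong hs).intervalIntegrable _ _) (by simp), h.integral_eq hv hs,
      intervalIntegral.integral_const, ← hσk]
    simp only [smul_eq_mul]
    ring
  · refine hle.trans_eq ?_
    congr 1
    rw [intervalIntegral.integral_const_mul, intervalIntegral.integral_add (by simp)
      ((continuous_sin.const_mul σ).intervalIntegrable _ _),
      intervalIntegral.integral_const_mul, integral_sin, intervalIntegral.integral_const]
    simp only [smul_eq_mul, cos_neg]
    ring

/-- Cauchy–Schwarz for `(cos s, x + sin s)` against the unit vector `(cos s, sin s)`. -/
theorem one_add_mul_le_sqrt {s x y : ℝ} :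
    1 + sin s * x ≤ √(cos s ^ 2 + (x + sin s) ^ 2 + y ^ 2) := by
  have h := sin_sq_add_cos_sq s
  refine Real.le_sqrt_of_sq_le ?_
  have e : cos s ^ 2 + (x + sin s) ^ 2 + y ^ 2 = (1 + sin s * x) ^ 2 + (cos s * x) ^ 2 + y ^ 2 := by
    linear_combination (1 - x ^ 2) * h
  rw [e, add_assoc]
  exact le_add_of_nonneg_right (by positivity)

theorem eq_zero_of_sqrt_eq {s x y : ℝ} (hs : 0 < cos s)
    (h : √(cos s ^ 2 + (x + sin s) ^ 2 + (cos s * y) ^ 2) = 1 + sin s * x) : x = 0 ∧ y = 0 := by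
  have h1 := sin_sq_add_cos_sq s
  have h2 : cos s ^ 2 + (x + sin s) ^ 2 + (cos s * y) ^ 2 = (1 + sin s * x) ^ 2 := by
    rw [← h, Real.sq_sqrt (by positivity)]
  have h3 : cos s ^ 2 * (x ^ 2 + y ^ 2) = 0 := by linear_combination h2 + (x ^ 2 - 1) * h1
  have h4 : x ^ 2 + y ^ 2 = 0 := (mul_eq_zero.1 h3).resolve_left (by positivity)
  constructor <;> nlinarith [sq_nonneg x, sq_nonneg y]

/-- With no winding, the lower bound `1 + sin s · θ_φ` integrates to `2π` on each parallel, so the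
assumed volume leaves no slack. The latitude derivative is needed on one meridian only, since the
angle is constant on parallels. -/
theorem IsUnitVectorField.angleDeriv_eq_zero (hv : IsUnitVectorField v)
    (hk : ∀ s ∈ Set.Ioo (-(π / 2)) (π / 2), ∃ Θ, IsAngleAlong v s 0 Θ)
    (hvol : vol v ≤ ENNReal.ofReal (2 * π ^ 2)) {s : ℝ} (hs : s ∈ Set.Ioo (-(π / 2)) (π / 2)) :
    (∀ φ, angleDerivLong v s φ = 0) ∧ angleDerivLat v s 0 = 0 := by
  rw [hv.vol_eq] at hvol
  have hle : ∀ s ∈ Set.Ioo (-(π / 2)) (π / 2), ∀ φ, 1 + sin s * angleDerivLong v s φ ≤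
      √(cos s ^ 2 + (angleDerivLong v s φ + sin s) ^ 2 + (cos s * angleDerivLat v s φ) ^ 2) :=
    fun s _ φ => one_add_mul_le_sqrt
  have hae := ae_eq_of_lintegral_le (G := fun s φ => 1 + sin s * angleDerivLong v s φ)
    (h := fun _ => 2 * π) hv.continuousOn_areaDensity (fun s φ => Real.sqrt_nonneg _)
    (fun s hs => continuous_const.add ((hv.continuous_angleDerivLong hs).const_mul _))
    hle continuous_const (fun s => by positivity)
    (fun s hs => ?_) ?_
  · have hae2 : ∀ᵐ s ∂(volume.restrict (Set.Ioo (-(π / 2)) (π / 2))), ∀ φ ∈ Set.Icc (-π) π,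
        angleDerivLong v s φ = 0 ∧ angleDerivLat v s φ = 0 := by
      filter_upwards [hae, ae_restrict_mem measurableSet_Ioo] with s h hs φ hφ
      exact eq_zero_of_sqrt_eq (cos_pos_of_mem_Ioo hs) (h φ hφ)
    -- Equality is known for almost every `s`; continuity in `s` extends the vanishing to all
    -- latitudes.
    have hlong : ∀ φ ∈ Set.Icc (-π) π, Set.EqOn (fun s => angleDerivLong v s φ) (fun _ => 0)
        (Set.Ioo (-(π / 2)) (π / 2)) := by
      intro φ hφ
      refine Measure.eqOn_open_of_ae_eq (μ := volume) ?_ isOpen_Ioo ?_ continuousOn_const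
      · filter_upwards [hae2] with s h using (h φ hφ).1
      · intro s hs
        exact ((hv.continuousAt_angleDerivLong (x := (s, φ)) hs).comp
          (f := fun s => (s, φ)) (by fun_prop)).continuousWithinAt
    have hlat : Set.EqOn (fun s => angleDerivLat v s 0) (fun _ => 0)
        (Set.Ioo (-(π / 2)) (π / 2)) := by
      refine Measure.eqOn_open_of_ae_eq (μ := volume) ?_ isOpen_Ioo ?_ continuousOn_const
      · filter_upwards [hae2] with s h using (h 0 ⟨by linarith [pi_pos], pi_pos.le⟩).2
      · intro s hs
        exact ((hv.continuousAt_angleDerivLat (x := (s, 0)) hs).comp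
          (f := fun s => (s, 0)) (by fun_prop)).continuousWithinAt
    refine ⟨fun φ => ?_, hlat hs⟩
    have hper : Function.Periodic (angleDerivLong v s) (2 * π) := angleDerivLong_add_two_pi v s
    obtain ⟨ψ, hψ, e⟩ := hper.exists_mem_Ico (by positivity) φ (-π)
    rw [e]
    exact hlong ψ ⟨hψ.1, by linarith [hψ.2]⟩ hs
  · obtain ⟨Θ, h⟩ := hk s hs
    rw [intervalIntegral.integral_add (by simp)
      (((hv.continuous_angleDerivLong hs).const_mul _).intervalIntegrable _ _),
      intervalIntegral.integral_const_mul, h.integral_eq hv hs, intervalIntegral.integral_const]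
    simp only [smul_eq_mul]
    push_cast
    ring
  · refine hvol.trans_eq ?_
    congr 1
    rw [intervalIntegral.integral_const]
    simp only [smul_eq_mul]
    ring

theorem IsUnitVectorField.isLoxodromic_of_angleDeriv_eq_zero (hv : IsUnitVectorField v)
    (h : ∀ s ∈ Set.Ioo (-(π / 2)) (π / 2),
      (∀ φ, angleDerivLong v s φ = 0) ∧ angleDerivLat v s 0 = 0) : IsLoxodromic v := by
  have h0 : (0 : ℝ) ∈ Set.Ioo (-(π / 2)) (π / 2) := ⟨by linarith [pi_pos], by linarith [pi_pos]⟩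
  have key : ∀ s ∈ Set.Ioo (-(π / 2)) (π / 2), ∀ φ,
      eastComp v s φ = eastComp v 0 0 ∧ northComp v s φ = northComp v 0 0 := by
    intro s hs φ
    have ha : ∀ φ, HasDerivAt (eastComp v s) 0 φ := fun φ =>
      (hv.hasDerivAt_long hs φ).1.congr_deriv (by rw [(h s hs).1 φ]; ring)
    have hb : ∀ φ, HasDerivAt (northComp v s) 0 φ := fun φ =>
      (hv.hasDerivAt_long hs φ).2.congr_deriv (by rw [(h s hs).1 φ]; ring)
    have ha' : ∀ s ∈ Set.Ioo (-(π / 2)) (π / 2), HasDerivAt (fun s => eastComp v s 0) 0 s :=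
      fun s hs => (hv.hasDerivAt_lat hs 0).1.congr_deriv (by rw [(h s hs).2]; ring)
    have hb' : ∀ s ∈ Set.Ioo (-(π / 2)) (π / 2), HasDerivAt (fun s => northComp v s 0) 0 s :=
      fun s hs => (hv.hasDerivAt_lat hs 0).2.congr_deriv (by rw [(h s hs).2]; ring)
    constructor
    · exact (is_const_of_deriv_eq_zero (fun φ => (ha φ).differentiableAt)
        (fun φ => (ha φ).deriv) φ 0).trans
        (isOpen_Ioo.is_const_of_deriv_eq_zero isPreconnected_Ioo
          (fun s hs => (ha' s hs).differentiableAt.differentiableWithinAt)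
          (fun s hs => (ha' s hs).deriv) hs h0)
    · exact (is_const_of_deriv_eq_zero (fun φ => (hb φ).differentiableAt)
        (fun φ => (hb φ).deriv) φ 0).trans
        (isOpen_Ioo.is_const_of_deriv_eq_zero isPreconnected_Ioo
          (fun s hs => (hb' s hs).differentiableAt.differentiableWithinAt)
          (fun s hs => (hb' s hs).deriv) hs h0)
  obtain ⟨k, Θ, hΘ⟩ := hv.exists_isAngleAlong h0
  refine ⟨Θ 0, fun p hp => ?_⟩
  obtain ⟨s, hs, φ, rfl⟩ := exists_spherePt hp
  rw [east_spherePt hs, meridian_spherePt hs, hv.eq_comp hs, (key s hs φ).1, (key s hs φ).2,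
    hΘ.eastComp_eq, hΘ.northComp_eq]

/-! ### The volume of loxodromic fields. -/

theorem IsLoxodromic.exists_comp_eq (h : IsLoxodromic v) :
    ∃ α : ℝ, ∀ s ∈ Set.Ioo (-(π / 2)) (π / 2), ∀ φ,
      eastComp v s φ = cos α ∧ northComp v s φ = sin α := by
  obtain ⟨α, hα⟩ := h
  refine ⟨α, fun s hs φ => ?_⟩
  unfold eastComp northComp
  rw [hα _ (spherePt_mem hs φ), east_spherePt hs, meridian_spherePt hs]
  simp only [inner_add_left, inner_smul_left, inner_eastPt_self, inner_northPt_self,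
    inner_eastPt_northPt, real_inner_comm (eastPt φ) (northPt s φ), conj_trivial]
  simp

theorem IsLoxodromic.angleDeriv_eq_zero (h : IsLoxodromic v) (hv : IsUnitVectorField v) {s : ℝ}
    (hs : s ∈ Set.Ioo (-(π / 2)) (π / 2)) (φ : ℝ) :
    angleDerivLong v s φ = 0 ∧ angleDerivLat v s φ = 0 := by
  obtain ⟨α, hα⟩ := h.exists_comp_eq
  have hq := hv.comp_sq hs φ
  have e1 : HasDerivAt (eastComp v s) 0 φ := (hasDerivAt_const φ (cos α)).congr_of_eventuallyEq
    (Eventually.of_forall fun φ => (hα s hs φ).1)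
  have e2 : HasDerivAt (northComp v s) 0 φ := (hasDerivAt_const φ (sin α)).congr_of_eventuallyEq
    (Eventually.of_forall fun φ => (hα s hs φ).2)
  have hmem := isOpen_Ioo.mem_nhds hs
  have e3 : HasDerivAt (fun s => eastComp v s φ) 0 s :=
    (hasDerivAt_const s (cos α)).congr_of_eventuallyEq
      (by filter_upwards [hmem] with s hs using (hα s hs φ).1)
  have e4 : HasDerivAt (fun s => northComp v s φ) 0 s :=
    (hasDerivAt_const s (sin α)).congr_of_eventuallyEq
      (by filter_upwards [hmem] with s hs using (hα s hs φ).2)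
  have d1 := (hv.hasDerivAt_long hs φ).1.unique e1
  have d2 := (hv.hasDerivAt_long hs φ).2.unique e2
  have d3 := (hv.hasDerivAt_lat hs φ).1.unique e3
  have d4 := (hv.hasDerivAt_lat hs φ).2.unique e4
  constructor
  · linear_combination (-angleDerivLong v s φ) * hq - northComp v s φ * d1 + eastComp v s φ * d2
  · linear_combination (-angleDerivLat v s φ) * hq - northComp v s φ * d3 + eastComp v s φ * d4

theorem IsLoxodromic.vol_eq (h : IsLoxodromic v) (hv : IsUnitVectorField v) :
    vol v = ENNReal.ofReal (2 * π ^ 2) := by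
  have e : ∀ s ∈ Set.Ioo (-(π / 2)) (π / 2), ∫⁻ φ in Set.Ioo (-π) π,
      ENNReal.ofReal √(cos s ^ 2 + (angleDerivLong v s φ + sin s) ^ 2 +
        (cos s * angleDerivLat v s φ) ^ 2) = ENNReal.ofReal (2 * π) := by
    intro s hs
    have : ∀ φ, √(cos s ^ 2 + (angleDerivLong v s φ + sin s) ^ 2 +
        (cos s * angleDerivLat v s φ) ^ 2) = 1 := by
      intro φ
      rw [(h.angleDeriv_eq_zero hv hs φ).1, (h.angleDeriv_eq_zero hv hs φ).2, Real.sqrt_eq_one]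
      linear_combination sin_sq_add_cos_sq s
    simp only [this, lintegral_const, ENNReal.ofReal_one, one_mul, Measure.restrict_apply_univ,
      Real.volume_Ioo]
    congr 1
    ring
  rw [hv.vol_eq, setLIntegral_congr_fun measurableSet_Ioo e, lintegral_const,
    Measure.restrict_apply_univ, Real.volume_Ioo, ← ENNReal.ofReal_mul (by positivity)]
  congr 1
  ring

end

/-! ### Comparison with the Brito–Chacón–Johnson bound. -/

theorem theorem2 (v : E3 → E3) (hv : IsUnitVectorField v) :
    (HasPoincareIndex v northPole (poincareIndex v northPole) ∧
      HasPoincareIndex v southPole (poincareIndex v southPole)) ∧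
    (vol v = ENNReal.ofReal (1 / 2 * (π + |(poincareIndex v northPole : ℝ)|
        + |(poincareIndex v southPole : ℝ)| - 2)) * volSphere ↔ IsLoxodromic v) ∧
    (IsLoxodromic v → vol v = ENNReal.ofReal (π / 2) * volSphere) := by
  obtain ⟨k, hk⟩ := hv.exists_winding
  have hN := hasPoincareIndex_northPole hv hk
  have hS := hasPoincareIndex_southPole hv hk
  have hpi : ENNReal.ofReal (π / 2) * volSphere = ENNReal.ofReal (2 * π ^ 2) := by
    rw [volSphere_eq, ← ENNReal.ofReal_mul (by positivity)]
    congr 1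
    ring
  rw [hN.poincareIndex_eq, hS.poincareIndex_eq]
  refine ⟨⟨hN, hS⟩, ⟨fun h => ?_, fun h => ?_⟩, fun h => by rw [h.vol_eq hv, hpi]⟩
  · rcases eq_or_ne k 0 with rfl | hk0
    · refine hv.isLoxodromic_of_angleDeriv_eq_zero fun s hs => hv.angleDeriv_eq_zero hk ?_ hs
      rw [h, ← hpi]
      apply le_of_eq
      congr 2
      norm_num
      ring
    · exfalso
      refine (hv.lt_vol_of_winding_ne_zero hk0 hk).not_ge ?_
      rw [h, volSphere_eq, ← ENNReal.ofReal_mul' (by positivity)]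
      apply ENNReal.ofReal_le_ofReal
      have hk1 : (1 : ℝ) ≤ |(k : ℝ)| := by exact_mod_cast Int.one_le_abs hk0
      -- In general the sum is `2 max(1, |k|)`; here `k ≠ 0`.
      have h1 : |((1 + k : ℤ) : ℝ)| + |((1 - k : ℤ) : ℝ)| = 2 * |(k : ℝ)| := by
        exact_mod_cast 
          (by simp only [abs_eq_max_neg]; omega : |1 + k| + |1 - k| = 2 * |k|)
      -- This amounts to `(π - 2)(|k| - 1) ≥ 0`.
      have h3 : π + |((1 + k : ℤ) : ℝ)| + |((1 - k : ℤ) : ℝ)| - 2 ≤ π * |(k : ℝ)| := by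
        nlinarith [pi_gt_three]
      nlinarith [pi_pos]
  -- For a loxodromic field the angle has zero derivative along the equator, so it makes no turn.
  · have hk0 : k = 0 := by
      have h0 : (0 : ℝ) ∈ Set.Ioo (-(π / 2)) (π / 2) :=
        ⟨by linarith [pi_pos], by linarith [pi_pos]⟩
      obtain ⟨Θ, hΘ⟩ := hk 0 h0
      have := hΘ.integral_eq hv h0
      simp only [(h.angleDeriv_eq_zero hv h0 _).1, intervalIntegral.integral_zero] at this
      have hpos : 2 * π ≠ 0 := by positivity
      exact_mod_cast (mul_eq_zero.1 this.symm).resolve_left hpos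
    subst hk0
    rw [h.vol_eq hv, ← hpi]
    congr 2
    norm_num
    ring
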